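/- Let $0<\beta\le 1$. There is a function $C=C_\beta:\mathbb{R}\times\mathbb{R}\to\mathbb{R}$, depending only on $\beta$, such that the following holds for all $b,\theta,R>0$. Let $\Sigma_1,\Sigma_2,\Sigma_3\subset\mathbb{R}^3$ be nonempty sets with $\operatorname{diam}\Sigma_i\le R$ for which there are sets $\Sigma_i^*$, open convex sets $U_i\subset\mathbb{R}^3$, functions $\Phi_i\in C^{1,\beta}(U_i)$ and maps $\mathfrak n_i$, $i=1,2,3$, such that: (o) $\Sigma_i$ is a bounded, relatively open subset of $\Sigma_i^*$; (i) $\Sigma_i^*=\{\sigma\in U_i : \Phi_i(\sigma)=0,\ \nabla\Phi_i(\sigma)\neq0\}$ and $\operatorname{dist}(\Sigma_i,U_i^c)\ge\operatorname{diam}(\Sigma_i)$; (ii) $\mathfrak n_i$ is a unit normal vector field on $\Sigma_i^*$ with $$\frac{|\mathfrak n_i(\sigma)-\mathfrak n_i(\tilde\sigma)|}{|\sigma-\tilde\sigma|^{\beta}}+\frac{|\mathfrak n_i(\sigma)\cdot(\sigma-\tilde\sigma)|}{|\sigma-\tilde\sigma|^{1+\beta}}\le b\qquad\text{for all }\sigma\ne\tilde\sigma\text{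 in }\Sigma_i^*;$$ (iii) $\theta\le\det\big(\mathfrak n_1(\sigma_1),\mathfrak n_2(\sigma_2),\mathfrak n_3(\sigma_3)\big)\le1$ for all $(\sigma_1,\sigma_2,\sigma_3)\in\Sigma_1^*\times\Sigma_2^*\times\Sigma_3^*$. Let $\mu_i$ be the surface measure on $\Sigma_i$ and $L^2(\Sigma_i)=L^2(\Sigma_i,\mu_i;\mathbb{C})$. For functions $u$ on $\Sigma_1$ and $v$ on $\Sigma_2$ let $u*v$ be the distribution $(u*v)(\psi)=\int_{\Sigma_1}\int_{\Sigma_2}u(x)v(y)\psi(x+y)\,d\mu_2(y)\,d\mu_1(x)$, $\psi\in C_c^\infty(\mathbb{R}^3)$. Then: (a) for $u\in C_c(\Sigma_1)$ and $v\in C_c(\Sigma_2)$ the distribution $u*v$ is given by a unique continuous function on $\mathbb{R}^3$, so it has a pointwise restriction $(u*v)|_{\Sigma_3}$; (b) for all $f\in L^2(\Sigma_1)$ and $g\in L^2(\Sigma_2)$ the restriction of $f*g$ to $\Sigma_3$ is a well-defined element of $L^2(\Sigma_3)$: there is exactly one $h=:(f*g)|_{\Sigma_3}\in L^2(\Sigma_3)$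 such that $(u_k*v_k)|_{\Sigma_3}\to h$ in $L^2(\Sigma_3)$ for all sequences $u_k\in C_c(\Sigma_1)$, $v_k\in C_c(\Sigma_2)$ with $u_k\to f$ in $L^2(\Sigma_1)$ and $v_k\to g$ in $L^2(\Sigma_2)$; and it satisfies $$\|f*g\|_{L^2(\Sigma_3)}\le C(R^\beta b,\theta)\,\|f\|_{L^2(\Sigma_1)}\,\|g\|_{L^2(\Sigma_2)}.$$ Here $\Phi\in C^{1,\beta}(U)$ means that $\Phi$ is $C^1$ on $U$ and $\nabla\Phi$ is $\beta$-Hölder continuous on every compact subset of $U$. -/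

import Mathlib

open MeasureTheory Filter Topology
open scoped ContDiff Gradient

/-- Euclidean space `ℝ³`. -/
abbrev R3 : Type := EuclideanSpace ℝ (Fin 3)

/-- `Φ ∈ C^{1,β}(U)`: continuously differentiable on the open set `U`, with gradient locally
`β`-Hölder continuous (i.e. `β`-Hölder on each compact subset of `U`). -/
def IsC1Holder (β : ℝ) (Φ : R3 → ℝ) (U : Set R3) : Prop :=
  ContDiffOn ℝ 1 Φ U ∧
    ∀ K : Set R3, IsCompact K → K ⊆ U →
      ∃ M : ℝ, ∀ x ∈ K, ∀ y ∈ K, ‖∇ Φ x - ∇ Φ y‖ ≤ M * dist x y ^ β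

/-- The regularity and Hölder conditions on a single oriented surface: `S` is a bounded, relatively
open piece of the larger surface `S'`, which is the regular part of the zero set of `Φ` in the
convex open set `U`, with unit normal field `n`. -/
structure IsHolderSurface (β b : ℝ) (S S' U : Set R3) (Φ : R3 → ℝ) (n : R3 → R3) : Prop where
  /-- `S` is relatively open in `S'`. -/
  relOpen : ∃ V : Set R3, IsOpen V ∧ S = S' ∩ V
  bounded : Bornology.IsBounded S
  isOpen_U : IsOpen U
  convex_U : Convex ℝ U
  /-- `dist (S, Uᶜ) ≥ diam S`. -/
  margin : ∀ x ∈ S, ∀ y ∉ U, Metric.diam S ≤ dist x y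
  regular : IsC1Holder β Φ U
  zeroSet : S' = {x | x ∈ U ∧ Φ x = 0 ∧ ∇ Φ x ≠ 0}
  /-- `n` is a unit vector field along `S'` ... -/
  unit : ∀ x ∈ S', ‖n x‖ = 1
  /-- ... which is normal to `S'`. -/
  normal : ∀ x ∈ S', ∃ c : ℝ, n x = c • ∇ Φ x
  holder : ∀ x ∈ S', ∀ y ∈ S', x ≠ y →
    ‖n x - n y‖ / dist x y ^ β + |inner ℝ (n x) (x - y)| / dist x y ^ (1 + β) ≤ b

/-- The standing assumption on the three surfaces `S 0, S 1, S 2`, with parameters `β, b, θ`: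
each is a Hölder surface, and the unit normals are uniformly transversal on the larger surfaces.
The matrix has the vector `n i (σ i)` as its `i`-th column. -/
def SurfaceAssumption (β b θ : ℝ) (S : Fin 3 → Set R3) : Prop :=
  ∃ (S' U : Fin 3 → Set R3) (Φ : Fin 3 → R3 → ℝ) (n : Fin 3 → R3 → R3),
    (∀ i, IsHolderSurface β b (S i) (S' i) (U i) (Φ i) (n i)) ∧
    ∀ σ : Fin 3 → R3, (∀ i, σ i ∈ S' i) →
      θ ≤ (Matrix.of fun k i : Fin 3 => n i (σ i) k).det ∧
        (Matrix.of fun k i : Fin 3 => n i (σ i) k).det ≤ 1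

/-- Surface measure: two-dimensional Hausdorff measure on `S`, normalized so that it agrees with
Lebesgue measure on planes. -/
noncomputable def surfaceMeasure (S : Set R3) : Measure R3 :=
  (μHE[2] : Measure R3).restrict S

/-- The distribution `f ∗ g` for functions `f` on `S₁` and `g` on `S₂`, evaluated at `ψ`. -/
noncomputable def surfaceConv (S₁ S₂ : Set R3) (f g ψ : R3 → ℂ) : ℂ :=
  ∫ x, ∫ y, f x * g y * ψ (x + y) ∂(surfaceMeasure S₂) ∂(surfaceMeasure S₁)

/-- The distribution `f ∗ g` is given by the continuous function `F` on `ℝ³`. -/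
def IsContinuousConv (S₁ S₂ : Set R3) (f g F : R3 → ℂ) : Prop :=
  Continuous F ∧
    ∀ ψ : R3 → ℂ, ContDiff ℝ ∞ ψ → HasCompactSupport ψ →
      ∫ z, F z * ψ z = surfaceConv S₁ S₂ f g ψ

/-- `u` is a continuous function on `S` with compact support in `S`, extended by zero. -/
def IsCcOn (S : Set R3) (u : R3 → ℂ) : Prop :=
  ContinuousOn u S ∧ ∃ K : Set R3, IsCompact K ∧ K ⊆ S ∧ ∀ x ∉ K, u x = 0

/-- `h` is the restriction to `S₃` of the convolution of `f ∈ L²(S₁)` and `g ∈ L²(S₂)`, defined by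
density: whenever `u k → f` in `L²(S₁)` and `v k → g` in `L²(S₂)` with `u k`, `v k` continuous and
compactly supported, the pointwise restrictions to `S₃` of the continuous functions
`F k = u k ∗ v k` converge to `h` in `L²(S₃)`. -/
def IsConvRestriction (S₁ S₂ S₃ : Set R3) (f g h : R3 → ℂ) : Prop :=
  ∀ u v F : ℕ → R3 → ℂ,
    (∀ k, IsCcOn S₁ (u k)) → (∀ k, IsCcOn S₂ (v k)) →
    (∀ k, IsContinuousConv S₁ S₂ (u k) (v k) (F k)) →
    Tendsto (fun k => eLpNorm (u k - f) 2 (surfaceMeasure S₁)) atTop (𝓝 0) →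
    Tendsto (fun k => eLpNorm (v k - g) 2 (surfaceMeasure S₂)) atTop (𝓝 0) →
    Tendsto (fun k => eLpNorm (F k - h) 2 (surfaceMeasure S₃)) atTop (𝓝 0)

section ConvolutionEstimate

open Metric Set
open scoped NNReal ENNReal

/-! ### The two-dimensional area formula for graphs -/

/-! Use the inner products with three normals, one from each surface, as linear coordinates. If the
surfaces were planes, each would be parallel to a coordinate plane, and `u * v` at `z` would be an
integral over the line of pairs `(x, y)` with `x + y = z`, parametrised by the third coordinate `t`
of `x`. Cauchy–Schwarz in `t`, followed by giving the two factors independent parameters `t` and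
`t'`, bounds the square by the double integral of `|u (x_t)|² |v (y_t')|²`. When `z` runs over the
third plane, `(z, t, t') ↦ (x_t, y_t')` is, up to signs and translations, a permutation of four
coordinates, and the L² bound (a Loomis–Whitney inequality) follows.

The argument survives curvature because only the distortion of measure matters. For graphs with
Lipschitz constant 1/8 the four-dimensional map shrinks distances by a factor 4 at most
(`antilipschitz_pairMap`), so integrals of compositions grow by at most `4 ^ 4`
(`lintegral_comp_le_of_antilipschitz`). Differentiability serves to identify the convolution
density, through a one-dimensional substitution (`integral_fibre`), and the surface measure, through
an area formula (`map_restrict_euclideanHausdorffMeasure`).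

Hölder surfaces reduce to this case on pieces of diameter at most `ρ` with `b ρ^β ≤ θ/288`: there
the normal turns so little that a piece is such a graph in coordinates whose inverse has norm at
most `18/θ` (`exists_graphChart`, `exists_coordinates`). The number of pieces is governed by `R/ρ =
(288 R^β b/θ)^(1/β)`, so the final constant depends only on `R^β b`, `θ` and `β`. A partition of
unity sums the local bounds, and bilinearity with density of compactly supported continuous
functions extends the result to L². -/

theorem LipschitzOnWith.euclideanHausdorffMeasure_two_image_le {X Y : Type*} [MetricSpace X]
    [MeasurableSpace X] [BorelSpace X] [MetricSpace Y] [MeasurableSpace Y] [BorelSpace Y]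
    {f : X → Y} {s : Set X} {K : ℝ≥0} (hf : LipschitzOnWith K f s) :
    μHE[2] (f '' s) ≤ (K : ℝ≥0∞) ^ 2 * μHE[2] s := by
  have h := hf.hausdorffMeasure_image_le (d := 2) (by norm_num)
  simp only [Measure.euclideanHausdorffMeasure_def, Measure.smul_apply]
  simp only [ENNReal.smul_def, smul_eq_mul]
  rw [mul_left_comm]
  gcongr
  simpa using h

/-- The hypothesis makes `f ∘ g⁻¹` well defined and `K`-Lipschitz on the image of `g`. It compares a
surface with its linear approximation without mapping one to the other explicitly. -/
theorem euclideanHausdorffMeasure_two_image_le_of_dist_le {Z X Y : Type*} [MetricSpace X]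
    [MeasurableSpace X] [BorelSpace X] [MetricSpace Y] [MeasurableSpace Y] [BorelSpace Y]
    {f : Z → Y} {g : Z → X} {s : Set Z} {K : ℝ} (hK : 0 ≤ K)
    (h : ∀ x ∈ s, ∀ y ∈ s, dist (f x) (f y) ≤ K * dist (g x) (g y)) :
    μHE[2] (f '' s) ≤ ENNReal.ofReal (K ^ 2) * μHE[2] (g '' s) := by
  rcases s.eq_empty_or_nonempty with rfl | ⟨z, -⟩
  · simp
  have : Nonempty Z := ⟨z⟩
  have hmem : ∀ x ∈ g '' s, Function.invFunOn g s x ∈ s := fun x hx => Function.invFunOn_mem hx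
  have heq : ∀ x ∈ g '' s, g (Function.invFunOn g s x) = x := fun x hx => Function.invFunOn_eq hx
  have himg : f '' s = (fun x => f (Function.invFunOn g s x)) '' (g '' s) := by
    rw [image_image]
    refine image_congr fun x hx => ?_
    have hgx : g x ∈ g '' s := mem_image_of_mem g hx
    have := h x hx _ (hmem _ hgx)
    rw [heq _ hgx, dist_self, mul_zero] at this
    exact dist_le_zero.1 this
  have hlip : LipschitzOnWith K.toNNReal (fun x => f (Function.invFunOn g s x)) (g '' s) := by
    refine LipschitzOnWith.of_dist_le_mul fun x hx y hy => ?_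
    have := h _ (hmem x hx) _ (hmem y hy)
    rwa [heq x hx, heq y hy, ← Real.coe_toNNReal K hK] at this
  rw [himg]
  refine hlip.euclideanHausdorffMeasure_two_image_le.trans_eq ?_
  rw [ENNReal.ofReal_pow hK]
  rfl

/-- The factor by which an injective linear map scales two-dimensional area. -/
noncomputable def areaFactor (A : ℝ × ℝ →L[ℝ] R3) : ℝ≥0∞ :=
  μHE[2] (A '' closedBall 0 1) / volume (closedBall (0 : ℝ × ℝ) 1)

theorem euclideanHausdorffMeasure_two_image_closedBall (A : ℝ × ℝ →L[ℝ] R3) (x : ℝ × ℝ) {r : ℝ}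
    (hr : 0 < r) :
    μHE[2] (A '' closedBall x r) = areaFactor A * volume (closedBall x r) := by
  have key : ∀ (x y : ℝ × ℝ) {r s : ℝ}, 0 < r → 0 < s →
      μHE[2] (A '' closedBall x r) ≤
        ENNReal.ofReal ((r / s) ^ 2) * μHE[2] (A '' closedBall y s) := by
    intro x y r s hr hs
    -- The dilation `v ↦ x + (r/s)(v - y)` carries one ball onto the other and commutes with `A` up
    -- to translation.
    have himg : A '' closedBall x r =
        (fun v => A (x + (r / s) • (v - y))) '' closedBall y s := by
      rw [← image_image (g := A) (f := fun v => x + (r / s) • (v - y))]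
      congr 1
      ext v
      simp only [mem_closedBall, mem_image, dist_eq_norm]
      constructor
      · intro hv
        refine ⟨y + (s / r) • (v - x), ?_, ?_⟩
        · rw [add_sub_cancel_left, norm_smul, Real.norm_of_nonneg (by positivity), div_mul_eq_mul_div,
            div_le_iff₀ hr]
          gcongr
        · rw [add_sub_cancel_left, smul_smul, div_mul_div_cancel₀ hs.ne', div_self hr.ne', one_smul,
            add_sub_cancel]
      · rintro ⟨u, hu, rfl⟩
        rw [add_sub_cancel_left, norm_smul, Real.norm_of_nonneg (by positivity), div_mul_eq_mul_div,
            div_le_iff₀ hs]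
        gcongr
    rw [himg]
    refine euclideanHausdorffMeasure_two_image_le_of_dist_le (by positivity) fun u _ v _ => ?_
    rw [dist_eq_norm, dist_eq_norm, ← map_sub, ← map_sub, add_sub_add_left_eq_sub, ← smul_sub,
      sub_sub_sub_cancel_right, map_smul, norm_smul, Real.norm_of_nonneg (by positivity)]
  have h1 : μHE[2] (A '' closedBall x r) =
      ENNReal.ofReal (r ^ 2) * μHE[2] (A '' closedBall 0 1) := by
    refine le_antisymm ?_ ?_
    · simpa using key x 0 hr one_pos
    · calc ENNReal.ofReal (r ^ 2) * μHE[2] (A '' closedBall 0 1)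
          ≤ ENNReal.ofReal (r ^ 2) * (ENNReal.ofReal ((1 / r) ^ 2) * μHE[2] (A '' closedBall x r)) := by
            gcongr
            exact key 0 x one_pos hr
        _ = μHE[2] (A '' closedBall x r) := by
            rw [← mul_assoc, ← ENNReal.ofReal_mul (by positivity), one_div, ← mul_pow,
              mul_inv_cancel₀ hr.ne']
            simp
  have h2 : volume (closedBall x r) =
      ENNReal.ofReal (r ^ 2) * volume (closedBall (0 : ℝ × ℝ) 1) := by
    rw [Measure.addHaar_closedBall' _ _ hr.le]
    simp
  have h3 : volume (closedBall (0 : ℝ × ℝ) 1) ≠ 0 :=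
    (measure_closedBall_pos _ _ one_pos).ne'
  have h4 : volume (closedBall (0 : ℝ × ℝ) 1) ≠ ⊤ := measure_closedBall_lt_top.ne
  rw [h1, h2, areaFactor, mul_left_comm, ENNReal.div_mul_cancel h3 h4]

theorem dist_le_of_linear_approx {A : ℝ × ℝ →L[ℝ] R3} {f : ℝ × ℝ → R3} {x y : ℝ × ℝ} {m δ : ℝ}
    (hA : ∀ v, m * ‖v‖ ≤ ‖A v‖) (hδ0 : 0 ≤ δ)
    (h : ‖f x - f y - A (x - y)‖ ≤ m * δ * ‖x - y‖) :
    dist (f x) (f y) ≤ (1 + δ) * dist (A x) (A y) ∧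
      (1 - δ) * dist (A x) (A y) ≤ dist (f x) (f y) := by
  have h1 : ‖f x - f y - A (x - y)‖ ≤ δ * ‖A (x - y)‖ := by
    refine h.trans ?_
    nlinarith [hA (x - y)]
  rw [dist_eq_norm, dist_eq_norm, ← map_sub]
  have h2 := norm_sub_norm_le (f x - f y) (A (x - y))
  have h3 := norm_sub_norm_le (A (x - y)) (f x - f y)
  rw [norm_sub_rev (A (x - y))] at h3
  constructor <;> linarith

/-- A map that is close to a linear map bounded below distorts the distances between image points by
factors in `[1 - δ, 1 + δ]`, hence areas by the squares of these. -/
theorem measure_image_of_linear_approx {A : ℝ × ℝ →L[ℝ] R3} {f : ℝ × ℝ → R3} {s : Set (ℝ × ℝ)}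
    {m δ : ℝ} (hA : ∀ v, m * ‖v‖ ≤ ‖A v‖) (hδ0 : 0 ≤ δ) (hδ1 : δ < 1)
    (h : ∀ x ∈ s, ∀ y ∈ s, ‖f x - f y - A (x - y)‖ ≤ m * δ * ‖x - y‖) :
    μHE[2] (f '' s) ≤ ENNReal.ofReal ((1 + δ) ^ 2) * μHE[2] (A '' s) ∧
      ENNReal.ofReal ((1 - δ) ^ 2) * μHE[2] (A '' s) ≤ μHE[2] (f '' s) := by
  have h' := fun x hx y hy => dist_le_of_linear_approx hA hδ0 (h x hx y hy)
  refine ⟨euclideanHausdorffMeasure_two_image_le_of_dist_le (by linarith)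
    fun x hx y hy => (h' x hx y hy).1, ?_⟩
  have hpos : 0 < 1 - δ := by linarith
  have h2 : μHE[2] (A '' s) ≤ ENNReal.ofReal ((1 - δ)⁻¹ ^ 2) * μHE[2] (f '' s) :=
    euclideanHausdorffMeasure_two_image_le_of_dist_le (by positivity) fun x hx y hy => by
      rw [← div_eq_inv_mul, le_div_iff₀ hpos, mul_comm]
      exact (h' x hx y hy).2
  calc _ ≤ ENNReal.ofReal ((1 - δ) ^ 2) *
        (ENNReal.ofReal ((1 - δ)⁻¹ ^ 2) * μHE[2] (f '' s)) := by gcongr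
    _ = μHE[2] (f '' s) := by
        rw [← mul_assoc, ← ENNReal.ofReal_mul (by positivity), ← mul_pow,
          mul_inv_cancel₀ hpos.ne']
        simp

theorem tendsto_of_eventually_ratio {α : Type*} {l : Filter α} {a : α → ℝ≥0∞} {L : ℝ≥0∞}
    (hL : L ≠ ⊤)
    (h : ∀ δ : ℝ, 0 < δ → δ < 1 → ∀ᶠ x in l, a x ≤ ENNReal.ofReal ((1 + δ) ^ 2) * L ∧
      ENNReal.ofReal ((1 - δ) ^ 2) * L ≤ a x) : Tendsto a l (𝓝 L) := by
  have hev : ∀ᶠ δ : ℝ in 𝓝[>] 0, 0 < δ ∧ δ < 1 := Ioo_mem_nhdsGT one_pos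
  have hup : Tendsto (fun δ : ℝ => ENNReal.ofReal ((1 + δ) ^ 2) * L) (𝓝[>] 0) (𝓝 L) := by
    have : Tendsto (fun δ : ℝ => ENNReal.ofReal ((1 + δ) ^ 2)) (𝓝 0) (𝓝 1) := by
      have : Continuous fun δ : ℝ => ENNReal.ofReal ((1 + δ) ^ 2) :=
        ENNReal.continuous_ofReal.comp (by fun_prop)
      simpa using this.tendsto 0
    simpa using ENNReal.Tendsto.mul_const (this.mono_left nhdsWithin_le_nhds) (Or.inr hL)
  have hlo : Tendsto (fun δ : ℝ => ENNReal.ofReal ((1 - δ) ^ 2) * L) (𝓝[>] 0) (𝓝 L) := by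
    have : Tendsto (fun δ : ℝ => ENNReal.ofReal ((1 - δ) ^ 2)) (𝓝 0) (𝓝 1) := by
      have : Continuous fun δ : ℝ => ENNReal.ofReal ((1 - δ) ^ 2) :=
        ENNReal.continuous_ofReal.comp (by fun_prop)
      simpa using this.tendsto 0
    simpa using ENNReal.Tendsto.mul_const (this.mono_left nhdsWithin_le_nhds) (Or.inr hL)
  rw [tendsto_order]
  constructor
  · intro b hb
    obtain ⟨δ, h1, h2, h3⟩ := ((hlo.eventually_const_lt hb).and hev).exists
    filter_upwards [h δ h2 h3] with x hx using h1.trans_le hx.2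
  · intro b hb
    obtain ⟨δ, h1, h2, h3⟩ := ((hup.eventually_lt_const hb).and hev).exists
    filter_upwards [h δ h2 h3] with x hx using hx.1.trans_lt h1

theorem exists_euclideanHausdorffMeasure_prod_real :
    ∃ c : ℝ≥0, (μHE[2] : Measure (ℝ × ℝ)) = c • volume := by
  refine ⟨Measure.addHaarScalarFactor (volume : Measure (EuclideanSpace ℝ (Fin 2))) μH[(2 : ℕ)], ?_⟩
  rw [Measure.euclideanHausdorffMeasure_def]
  congr 1
  exact_mod_cast hausdorffMeasure_prod_real

/-- The constant relating normalized Hausdorff measure for the sup norm to Lebesgue measure. -/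
noncomputable def areaConst : ℝ≥0 := exists_euclideanHausdorffMeasure_prod_real.choose

theorem euclideanHausdorffMeasure_prod_real :
    (μHE[2] : Measure (ℝ × ℝ)) = areaConst • volume :=
  exists_euclideanHausdorffMeasure_prod_real.choose_spec

theorem areaFactor_le {A : ℝ × ℝ →L[ℝ] R3} {K : ℝ≥0} (hA : ‖A‖ ≤ K) :
    areaFactor A ≤ (K ^ 2 * areaConst : ℝ≥0) := by
  have h1 : LipschitzOnWith K A (closedBall 0 1) :=
    (A.lipschitz.weaken hA).lipschitzOnWith
  have h3 : volume (closedBall (0 : ℝ × ℝ) 1) ≠ 0 :=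
    (measure_closedBall_pos _ _ one_pos).ne'
  have h4 : volume (closedBall (0 : ℝ × ℝ) 1) ≠ ⊤ := measure_closedBall_lt_top.ne
  refine ENNReal.div_le_of_le_mul ?_
  refine h1.euclideanHausdorffMeasure_two_image_le.trans_eq ?_
  rw [euclideanHausdorffMeasure_prod_real, Measure.smul_apply]
  simp [ENNReal.smul_def, mul_assoc]

/-- Nearby linear maps approximate each other on the unit ball, so `measure_image_of_linear_approx`
gives continuity without a formula for the factor. -/
theorem continuousOn_areaFactor {D : Set (ℝ × ℝ)} {G' : ℝ × ℝ → ℝ × ℝ →L[ℝ] R3} {m : ℝ}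
    (hm : 0 < m) (hG : ∀ p ∈ D, ∀ v, m * ‖v‖ ≤ ‖G' p v‖) (hc : ContinuousOn G' D) :
    ContinuousOn (fun p => areaFactor (G' p)) D := by
  intro p hp
  refine tendsto_of_eventually_ratio ?_ fun δ h0 h1 => ?_
  · exact ne_top_of_le_ne_top ENNReal.coe_ne_top
      (areaFactor_le (A := G' p) (K := ‖G' p‖₊) (by simp))
  · have hev : ∀ᶠ q in 𝓝[D] p, ‖G' q - G' p‖ < m * δ := by
      have := (hc p hp).eventually (ball_mem_nhds (G' p) (mul_pos hm h0))
      simpa [dist_eq_norm] using this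
    filter_upwards [hev] with q hq
    have := measure_image_of_linear_approx (A := G' p) (f := G' q) (s := closedBall 0 1)
      (hG p hp) h0.le h1 (fun x _ y _ => by
        rw [← map_sub, ← _root_.sub_apply]
        exact (ContinuousLinearMap.le_opNorm _ _).trans (by gcongr))
    simp only [areaFactor, ← mul_div_assoc]
    exact ⟨ENNReal.div_le_div_right this.1 _, ENNReal.div_le_div_right this.2 _⟩

/-- By the chain rule `π ∘ A` is the identity, so `‖v‖ ≤ ‖π‖ ‖A v‖`. The added 1 makes the constant
positive without further argument. -/
theorem norm_le_of_leftInverse {D : Set (ℝ × ℝ)} (hD : IsOpen D) {G : ℝ × ℝ → R3}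
    {π : R3 →L[ℝ] ℝ × ℝ} (hπ : ∀ p ∈ D, π (G p) = p) {p : ℝ × ℝ} (hp : p ∈ D)
    {A : ℝ × ℝ →L[ℝ] R3} (hA : HasFDerivAt G A p) (v : ℝ × ℝ) :
    (‖π‖ + 1)⁻¹ * ‖v‖ ≤ ‖A v‖ := by
  have h1 : HasFDerivAt (fun q => π (G q)) (π.comp A) p := π.hasFDerivAt.comp p hA
  have h2 : HasFDerivAt (fun q => π (G q)) (ContinuousLinearMap.id ℝ (ℝ × ℝ)) p :=
    (hasFDerivAt_id p).congr_of_eventuallyEq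
      (by filter_upwards [hD.mem_nhds hp] with q hq using hπ q hq)
  have h3 : π (A v) = v := by
    simpa using congrArg (fun B => B v) (h1.unique h2)
  have h4 := π.le_opNorm (A v)
  rw [h3] at h4
  rw [inv_mul_le_iff₀ (by positivity)]
  nlinarith [norm_nonneg (A v)]

/-- Area formula for a `C¹` parametrization with a linear left inverse. -/
theorem map_restrict_euclideanHausdorffMeasure {D : Set (ℝ × ℝ)} (hD : IsOpen D)
    {G : ℝ × ℝ → R3} {G' : ℝ × ℝ → ℝ × ℝ →L[ℝ] R3} {π : R3 →L[ℝ] ℝ × ℝ} {K : ℝ≥0}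
    (hπ : ∀ p ∈ D, π (G p) = p) (hG : ∀ p ∈ D, HasFDerivAt G (G' p) p)
    (hc : ContinuousOn G' D) (hK : LipschitzOnWith K G D) :
    ((μHE[2] : Measure R3).restrict (G '' D)).map π =
      (volume.restrict D).withDensity (fun p => areaFactor (G' p)) := by
  set ρ : Measure (ℝ × ℝ) := ((μHE[2] : Measure R3).restrict (G '' D)).map π with hρ
  have hρA : ∀ s, MeasurableSet s → ρ s = μHE[2] (G '' (s ∩ D)) := by
    intro s hs
    rw [hρ, Measure.map_apply π.continuous.measurable hs,
      Measure.restrict_apply (π.continuous.measurable hs)]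
    congr 1
    ext x
    constructor
    · rintro ⟨h1, p, hp, rfl⟩
      exact ⟨p, ⟨by simpa [hπ p hp] using h1, hp⟩, rfl⟩
    · rintro ⟨p, ⟨h1, hp⟩, rfl⟩
      exact ⟨by simpa [hπ p hp] using h1, p, hp, rfl⟩
  -- The Lipschitz bound gives absolute continuity, so the measure is recovered from its
  -- Radon–Nikodym derivative, which is computed below as a limit of ratios over shrinking balls.
  have hle : ρ ≤ (K ^ 2 * areaConst : ℝ≥0) • volume := by
    refine Measure.le_intro fun s hs _ => ?_
    rw [hρA s hs]
    refine ((hK.mono inter_subset_right).euclideanHausdorffMeasure_two_image_le).trans ?_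
    rw [euclideanHausdorffMeasure_prod_real, Measure.smul_apply, Measure.smul_apply,
      ENNReal.smul_def, ENNReal.smul_def, smul_eq_mul, smul_eq_mul, ENNReal.coe_mul,
      ENNReal.coe_pow, mul_assoc]
    gcongr
    exact inter_subset_left
  have : IsLocallyFiniteMeasure ρ := Measure.isLocallyFiniteMeasure_of_le hle
  have hac : ρ ≪ volume := (Measure.absolutelyContinuous_of_le hle).trans
    (Measure.smul_absolutelyContinuous)
  set m : ℝ := (‖π‖ + 1)⁻¹
  have hm : 0 < m := by positivity
  have hlow : ∀ p ∈ D, ∀ v, m * ‖v‖ ≤ ‖G' p v‖ := fun p hp v =>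
    norm_le_of_leftInverse hD hπ hp (hG p hp) v
  have hlim : ∀ p ∈ D, Tendsto (fun r => ρ (closedBall p r) / volume (closedBall p r)) (𝓝[>] 0)
      (𝓝 (areaFactor (G' p))) := by
    intro p hp
    refine tendsto_of_eventually_ratio ?_ fun δ h0 h1 => ?_
    · exact ne_top_of_le_ne_top ENNReal.coe_ne_top
        (areaFactor_le (A := G' p) (K := ‖G' p‖₊) (by simp))
    -- Strict differentiability controls differences between any two points of a small ball, as the
    -- bi-Lipschitz comparison requires.
    have hstrict : HasStrictFDerivAt G (G' p) p :=
      hasStrictFDerivAt_of_hasFDerivAt_of_continuousAt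
        (by filter_upwards [hD.mem_nhds hp] with q hq using hG q hq)
        (hc.continuousAt (hD.mem_nhds hp))
    have hmδ : 0 < m * δ := mul_pos hm h0
    obtain ⟨s, hs, hs'⟩ := hstrict.approximates_deriv_on_nhds (c := (m * δ).toNNReal)
      (Or.inr (by simpa using hmδ))
    obtain ⟨r₀, hr₀, hball⟩ := Metric.nhds_basis_closedBall.mem_iff.1
      (inter_mem hs (hD.mem_nhds hp))
    have hIoo : Ioo (0 : ℝ) r₀ ∈ 𝓝[>] (0 : ℝ) := Ioo_mem_nhdsGT hr₀
    filter_upwards [hIoo] with r hr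
    have hsub : closedBall p r ⊆ s ∩ D := (closedBall_subset_closedBall hr.2.le).trans hball
    have hv0 : volume (closedBall p r) ≠ 0 := (measure_closedBall_pos _ _ hr.1).ne'
    have hv1 : volume (closedBall p r) ≠ ⊤ := measure_closedBall_lt_top.ne
    have := measure_image_of_linear_approx (A := G' p) (f := G) (s := closedBall p r)
      (hlow p hp) h0.le h1 (fun x hx y hy => by
        have := hs' x (hsub hx).1 y (hsub hy).1
        rwa [Real.coe_toNNReal _ hmδ.le] at this)
    rw [hρA _ measurableSet_closedBall,
      inter_eq_left.2 (hsub.trans inter_subset_right)]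
    rw [euclideanHausdorffMeasure_two_image_closedBall _ _ hr.1, ← mul_assoc, ← mul_assoc] at this
    exact ⟨ENNReal.div_le_of_le_mul this.1,
      (ENNReal.le_div_iff_mul_le (Or.inl hv0) (Or.inl hv1)).2 this.2⟩
  have hrn : (ρ.rnDeriv volume) =ᵐ[volume.restrict D] fun p => areaFactor (G' p) := by
    rw [Filter.EventuallyEq, ae_restrict_iff' hD.measurableSet]
    filter_upwards [Besicovitch.ae_tendsto_rnDeriv ρ volume] with p hp hpD
    exact tendsto_nhds_unique hp (hlim p hpD)
  have hρD : ρ = ρ.restrict D := by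
    refine (Measure.restrict_eq_self_of_ae_mem ?_).symm
    rw [ae_iff]
    have : {a | a ∉ D} = Dᶜ := rfl
    rw [this, hρA _ hD.measurableSet.compl]
    simp
  rw [← withDensity_congr_ae hrn, ← restrict_withDensity hD.measurableSet,
    Measure.withDensity_rnDeriv_eq _ _ hac]
  exact hρD

/-! ### The convolution estimate for graphs of functions with small Lipschitz constant -/

/-- Functions on the plane with small Lipschitz constant. -/
def SmallLip (φ : ℝ × ℝ → ℝ) : Prop :=
  ∀ p q : ℝ × ℝ, |φ p - φ q| ≤ (1 / 8) * (|p.1 - q.1| + |p.2 - q.2|)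

theorem SmallLip.continuous {φ : ℝ × ℝ → ℝ} (h : SmallLip φ) : Continuous φ := by
  refine (LipschitzWith.of_dist_le_mul (K := 1) fun p q => ?_).continuous
  have h1 : |p.1 - q.1| ≤ dist p q := le_max_left _ _
  have h2 : |p.2 - q.2| ≤ dist p q := le_max_right _ _
  have := h p q
  rw [Real.dist_eq, NNReal.coe_one]
  linarith [abs_nonneg (p.1 - q.1)]

theorem SmallLip.abs_deriv_le {φ : ℝ × ℝ → ℝ} (h : SmallLip φ) {p : ℝ × ℝ} {a : ℝ}
    (ha : HasDerivAt (fun s => φ (s, p.2)) a p.1) : |a| ≤ 1 / 8 := by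
  refine ha.le_of_lip' (by norm_num) (Eventually.of_forall fun x => ?_)
  simpa using h (x, p.2) (p.1, p.2)

/-- Composing two functions of Lipschitz constant 1/8 gives constant 1/64 in `s`, so the equation is
a fixed-point problem for a contraction. -/
theorem exists_eq_add_comp {φ₁ φ₂ : ℝ × ℝ → ℝ} (h₁ : SmallLip φ₁) (h₂ : SmallLip φ₂)
    (t : ℝ) (z : (ℝ × ℝ) × ℝ) :
    ∃ s : ℝ, s + φ₂ (z.1.1 - φ₁ (s, t), z.1.2 - t) = z.2 := by
  have hc : ContractingWith (1 / 2)
      (fun s : ℝ => z.2 - φ₂ (z.1.1 - φ₁ (s, t), z.1.2 - t)) := by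
    refine ⟨by norm_num, LipschitzWith.of_dist_le_mul fun x y => ?_⟩
    have e1 := h₂ (z.1.1 - φ₁ (x, t), z.1.2 - t) (z.1.1 - φ₁ (y, t), z.1.2 - t)
    have e2 := h₁ (x, t) (y, t)
    simp only [sub_self, abs_zero, add_zero, sub_sub_sub_cancel_left] at e1 e2
    rw [abs_sub_comm (φ₁ (y, t))] at e1
    rw [Real.dist_eq, Real.dist_eq, sub_sub_sub_cancel_left, abs_sub_comm]
    push_cast
    linarith [abs_nonneg (x - y)]
  refine ⟨ContractingWith.fixedPoint _ hc, ?_⟩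
  have : _ - _ = _ := hc.fixedPoint_isFixedPt
  linarith

/-- The term in `|s - s'|` on the right carries the factor 1/64 and is absorbed. Uniqueness of the
solution and its Lipschitz dependence on the data come from the same inequality. -/
theorem abs_sub_le_of_eq_add_comp {φ₁ φ₂ : ℝ × ℝ → ℝ} (h₁ : SmallLip φ₁) (h₂ : SmallLip φ₂)
    {s t s' t' : ℝ} {z z' : (ℝ × ℝ) × ℝ}
    (hs : s + φ₂ (z.1.1 - φ₁ (s, t), z.1.2 - t) = z.2)
    (hs' : s' + φ₂ (z'.1.1 - φ₁ (s', t'), z'.1.2 - t') = z'.2) :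
    |s - s'| ≤ 2 * (|z.2 - z'.2| + |z.1.1 - z'.1.1| + |z.1.2 - z'.1.2| + |t - t'|) := by
  have e1 := h₂ (z.1.1 - φ₁ (s, t), z.1.2 - t) (z'.1.1 - φ₁ (s', t'), z'.1.2 - t')
  have e2 := h₁ (s, t) (s', t')
  simp only at e1 e2
  have e3 : |z.1.1 - φ₁ (s, t) - (z'.1.1 - φ₁ (s', t'))| ≤
      |z.1.1 - z'.1.1| + |φ₁ (s, t) - φ₁ (s', t')| := by
    rw [sub_sub_sub_comm]; exact abs_sub _ _
  have e4 : |z.1.2 - t - (z'.1.2 - t')| ≤ |z.1.2 - z'.1.2| + |t - t'| := by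
    rw [sub_sub_sub_comm]; exact abs_sub _ _
  have e5 : |s - s'| ≤ |z.2 - z'.2| + |φ₂ (z.1.1 - φ₁ (s, t), z.1.2 - t) -
      φ₂ (z'.1.1 - φ₁ (s', t'), z'.1.2 - t')| := by
    have : s - s' = (z.2 - z'.2) - (φ₂ (z.1.1 - φ₁ (s, t), z.1.2 - t) -
      φ₂ (z'.1.1 - φ₁ (s', t'), z'.1.2 - t')) := by linarith
    rw [this]; exact abs_sub _ _
  linarith [abs_nonneg (z.2 - z'.2), abs_nonneg (z.1.1 - z'.1.1), abs_nonneg (z.1.2 - z'.1.2),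
    abs_nonneg (t - t'), abs_nonneg (s - s')]

/-! ### The one-dimensional fibre of the sum map. -/

section Solution

variable {φ₁ φ₂ : ℝ × ℝ → ℝ} (h₁ : SmallLip φ₁) (h₂ : SmallLip φ₂)

/-- The parameter `s` for which the point of the first graph over `(s, t)` and the point of the
second graph over `(z₁ - φ₁ (s, t), z₃ - t)` add up to the point `z`. -/
noncomputable def fibreParam (p : ℝ × ((ℝ × ℝ) × ℝ)) : ℝ :=
  (exists_eq_add_comp h₁ h₂ p.1 p.2).choose

theorem fibreParam_spec (t : ℝ) (z : (ℝ × ℝ) × ℝ) :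
    fibreParam h₁ h₂ (t, z) +
      φ₂ (z.1.1 - φ₁ (fibreParam h₁ h₂ (t, z), t), z.1.2 - t) = z.2 :=
  (exists_eq_add_comp h₁ h₂ t z).choose_spec

theorem fibreParam_eq {s t : ℝ} {z : (ℝ × ℝ) × ℝ}
    (hs : s + φ₂ (z.1.1 - φ₁ (s, t), z.1.2 - t) = z.2) : fibreParam h₁ h₂ (t, z) = s := by
  have := abs_sub_le_of_eq_add_comp h₁ h₂ (fibreParam_spec h₁ h₂ t z) hs
  simp only [sub_self, abs_zero, add_zero, mul_zero] at this
  exact sub_eq_zero.1 (abs_nonpos_iff.1 this)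

theorem continuous_fibreParam : Continuous (fibreParam h₁ h₂) := by
  refine (LipschitzWith.of_dist_le_mul (K := 8) fun p q => ?_).continuous
  have := abs_sub_le_of_eq_add_comp h₁ h₂ (fibreParam_spec h₁ h₂ p.1 p.2)
    (fibreParam_spec h₁ h₂ q.1 q.2)
  have e1 : |p.1 - q.1| ≤ dist p q := le_max_left _ _
  have e2 : |p.2.2 - q.2.2| ≤ dist p q := (le_max_right _ _ : dist p.2.2 q.2.2 ≤ _).trans
    (le_max_right _ _)
  have e3 : |p.2.1.1 - q.2.1.1| ≤ dist p q :=
    (((le_max_left _ _ : dist p.2.1.1 q.2.1.1 ≤ dist p.2.1 q.2.1)).trans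
    (le_max_left _ _ : dist p.2.1 q.2.1 ≤ dist p.2 q.2)).trans (le_max_right _ _)
  have e4 : |p.2.1.2 - q.2.1.2| ≤ dist p q :=
    (((le_max_right _ _ : dist p.2.1.2 q.2.1.2 ≤ dist p.2.1 q.2.1)).trans
    (le_max_left _ _ : dist p.2.1 q.2.1 ≤ dist p.2 q.2)).trans (le_max_right _ _)
  rw [Real.dist_eq]
  push_cast
  linarith

/-- The pair of points of the parameter planes which add up to `z` and for which the first point
has second coordinate `t`. -/
noncomputable def fibrePair (p : ℝ × ((ℝ × ℝ) × ℝ)) : (ℝ × ℝ) × (ℝ × ℝ) :=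
  ((fibreParam h₁ h₂ p, p.1),
    (p.2.1.1 - φ₁ (fibreParam h₁ h₂ p, p.1), p.2.1.2 - p.1))

theorem continuous_fibrePair : Continuous (fibrePair h₁ h₂) := by
  have := continuous_fibreParam h₁ h₂
  have := h₁.continuous
  unfold fibrePair
  fun_prop

/-- The map `(x, y) ↦ (t, x + y)` in the coordinates of the parameter planes. -/
def graphSum (φ₁ φ₂ : ℝ × ℝ → ℝ) (x : (ℝ × ℝ) × (ℝ × ℝ)) : ℝ × ((ℝ × ℝ) × ℝ) :=
  (x.1.2, ((φ₁ x.1 + x.2.1, x.1.2 + x.2.2), x.1.1 + φ₂ x.2))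

include h₁ h₂ in
theorem continuous_graphSum : Continuous (graphSum φ₁ φ₂) := by
  have := h₁.continuous
  have := h₂.continuous
  unfold graphSum
  fun_prop

theorem graphSum_fibrePair (p : ℝ × ((ℝ × ℝ) × ℝ)) : graphSum φ₁ φ₂ (fibrePair h₁ h₂ p) = p := by
  have := fibreParam_spec h₁ h₂ p.1 p.2
  ext <;> simp [graphSum, fibrePair]
  exact this

end Solution

/-- The map of four-dimensional space whose distortion controls the trilinear form. -/
noncomputable def pairMap {φ₁ φ₂ : ℝ × ℝ → ℝ} (h₁ : SmallLip φ₁) (h₂ : SmallLip φ₂)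
    (φ₃ : ℝ × ℝ → ℝ) (x : (ℝ × ℝ) × (ℝ × ℝ)) : (ℝ × ℝ) × (ℝ × ℝ) :=
  ((fibrePair h₁ h₂ (x.2.1, ((x.1.1, φ₃ x.1), x.1.2))).1,
    (fibrePair h₁ h₂ (x.2.2, ((x.1.1, φ₃ x.1), x.1.2))).2)

theorem continuous_pairMap {φ₁ φ₂ φ₃ : ℝ × ℝ → ℝ} (h₁ : SmallLip φ₁) (h₂ : SmallLip φ₂)
    (h₃ : SmallLip φ₃) : Continuous (pairMap h₁ h₂ φ₃) := by
  have := h₃.continuous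
  exact ((continuous_fibrePair h₁ h₂).comp
    (f := fun x : (ℝ × ℝ) × (ℝ × ℝ) => (x.2.1, ((x.1.1, φ₃ x.1), x.1.2))) (by fun_prop)).fst.prodMk
    ((continuous_fibrePair h₁ h₂).comp
      (f := fun x : (ℝ × ℝ) × (ℝ × ℝ) => (x.2.2, ((x.1.1, φ₃ x.1), x.1.2))) (by fun_prop)).snd

/-- For vanishing `φ`s the map is `((x₁, x₂), (t, t')) ↦ ((x₂, t), (x₁, -t'))`, an isometry. The
perturbations have small Lipschitz constants, so the source coordinates can still be recovered with
a loss of at most 4. -/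
theorem antilipschitz_pairMap {φ₁ φ₂ φ₃ : ℝ × ℝ → ℝ} (h₁ : SmallLip φ₁) (h₂ : SmallLip φ₂)
    (h₃ : SmallLip φ₃) : AntilipschitzWith 4 (pairMap h₁ h₂ φ₃) := by
  refine AntilipschitzWith.of_le_mul_dist fun x y => ?_
  obtain ⟨⟨x1, x2⟩, xt, xt'⟩ := x
  obtain ⟨⟨y1, y2⟩, yt, yt'⟩ := y
  have sx := fibreParam_spec h₁ h₂ xt ((x1, φ₃ (x1, x2)), x2)
  have sx' := fibreParam_spec h₁ h₂ xt' ((x1, φ₃ (x1, x2)), x2)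
  have sy := fibreParam_spec h₁ h₂ yt ((y1, φ₃ (y1, y2)), y2)
  have sy' := fibreParam_spec h₁ h₂ yt' ((y1, φ₃ (y1, y2)), y2)
  simp only [pairMap, fibrePair, Prod.dist_eq, Real.dist_eq]
  set a := fibreParam h₁ h₂ (xt, ((x1, φ₃ (x1, x2)), x2))
  set a' := fibreParam h₁ h₂ (xt', ((x1, φ₃ (x1, x2)), x2))
  set b := fibreParam h₁ h₂ (yt, ((y1, φ₃ (y1, y2)), y2))
  set b' := fibreParam h₁ h₂ (yt', ((y1, φ₃ (y1, y2)), y2))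
  simp only at sx sx' sy sy'
  set η := max (max |a - b| |xt - yt|)
    (max |x1 - φ₁ (a', xt') - (y1 - φ₁ (b', yt'))| |φ₃ (x1, x2) - xt' - (φ₃ (y1, y2) - yt')|)
    with hη
  have n1 : |a - b| ≤ η := (le_max_left _ _).trans (le_max_left _ _)
  have n2 : |xt - yt| ≤ η := (le_max_right _ _).trans (le_max_left _ _)
  have n3 : |x1 - φ₁ (a', xt') - (y1 - φ₁ (b', yt'))| ≤ η :=
    (le_max_left _ _).trans (le_max_right _ _)
  have n4 : |φ₃ (x1, x2) - xt' - (φ₃ (y1, y2) - yt')| ≤ η :=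
    (le_max_right _ _).trans (le_max_right _ _)
  have f3 := h₃ (x1, x2) (y1, y2)
  have f1 := h₁ (a, xt) (b, yt)
  have f1' := h₁ (a', xt') (b', yt')
  have f2 := h₂ (x1 - φ₁ (a, xt), φ₃ (x1, x2) - xt) (y1 - φ₁ (b, yt), φ₃ (y1, y2) - yt)
  have f2' := h₂ (x1 - φ₁ (a', xt'), φ₃ (x1, x2) - xt') (y1 - φ₁ (b', yt'), φ₃ (y1, y2) - yt')
  simp only at f1 f1' f2 f2' f3
  -- The inequalities `g1` to `g4` solve the defining equations for the differences of `xt'`, `x1`,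
  -- `a'` and `x2`; each error term carries a factor 1/8, so the linear system closes.
  have g1 : |xt' - yt'| ≤ η + |φ₃ (x1, x2) - φ₃ (y1, y2)| := by
    have e : xt' - yt' = (φ₃ (x1, x2) - φ₃ (y1, y2)) -
      (φ₃ (x1, x2) - xt' - (φ₃ (y1, y2) - yt')) := by ring
    rw [e]
    linarith [abs_sub (φ₃ (x1, x2) - φ₃ (y1, y2)) (φ₃ (x1, x2) - xt' - (φ₃ (y1, y2) - yt'))]
  have g2 : |x1 - y1| ≤ η + |φ₁ (a', xt') - φ₁ (b', yt')| := by
    have e : x1 - y1 = (x1 - φ₁ (a', xt') - (y1 - φ₁ (b', yt'))) +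
      (φ₁ (a', xt') - φ₁ (b', yt')) := by ring
    rw [e]
    linarith [abs_add_le (x1 - φ₁ (a', xt') - (y1 - φ₁ (b', yt'))) (φ₁ (a', xt') - φ₁ (b', yt'))]
  have g3 : |a' - b'| ≤ |x2 - y2| + |φ₂ (x1 - φ₁ (a', xt'), φ₃ (x1, x2) - xt') -
      φ₂ (y1 - φ₁ (b', yt'), φ₃ (y1, y2) - yt')| := by
    have e : a' - b' = (x2 - y2) - (φ₂ (x1 - φ₁ (a', xt'), φ₃ (x1, x2) - xt') -
      φ₂ (y1 - φ₁ (b', yt'), φ₃ (y1, y2) - yt')) := by linarith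
    rw [e]; exact abs_sub _ _
  have g4 : |x2 - y2| ≤ |a - b| + |φ₂ (x1 - φ₁ (a, xt), φ₃ (x1, x2) - xt) -
      φ₂ (y1 - φ₁ (b, yt), φ₃ (y1, y2) - yt)| := by
    have e : x2 - y2 = (a - b) + (φ₂ (x1 - φ₁ (a, xt), φ₃ (x1, x2) - xt) -
      φ₂ (y1 - φ₁ (b, yt), φ₃ (y1, y2) - yt)) := by linarith
    rw [e]; exact abs_add_le _ _
  have g5 : |x1 - φ₁ (a, xt) - (y1 - φ₁ (b, yt))| ≤ |x1 - y1| + |φ₁ (a, xt) - φ₁ (b, yt)| := by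
    rw [sub_sub_sub_comm]; exact abs_sub _ _
  have g6 : |φ₃ (x1, x2) - xt - (φ₃ (y1, y2) - yt)| ≤
      |φ₃ (x1, x2) - φ₃ (y1, y2)| + |xt - yt| := by
    rw [sub_sub_sub_comm]; exact abs_sub _ _
  have hη0 : 0 ≤ η := (abs_nonneg _).trans n1
  have k1 := abs_nonneg (x1 - y1)
  have k2 := abs_nonneg (x2 - y2)
  have k3 := abs_nonneg (xt' - yt')
  have k4 := abs_nonneg (a' - b')
  push_cast
  refine max_le (max_le ?_ ?_) (max_le ?_ ?_) <;> linarith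

/-- Haar measure is a multiple of Hausdorff measure, and preimages under an antilipschitz map have
controlled Hausdorff measure. This replaces a change of variables: neither differentiability nor
surjectivity is needed. -/
theorem lintegral_comp_le_of_antilipschitz {E : Type*} [NormedAddCommGroup E] [NormedSpace ℝ E]
    [FiniteDimensional ℝ E] [MeasurableSpace E] [BorelSpace E] (μ : Measure E) [μ.IsAddHaarMeasure]
    {f : E → E} {K : ℝ≥0} (hf : AntilipschitzWith K f) (hc : Continuous f) {h : E → ℝ≥0∞}
    (hh : Measurable h) :
    ∫⁻ x, h (f x) ∂μ ≤ (K : ℝ≥0∞) ^ Module.finrank ℝ E * ∫⁻ x, h x ∂μ := by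
  have hle : μ.map f ≤ (K ^ Module.finrank ℝ E : ℝ≥0) • μ := by
    refine Measure.le_intro fun s hs _ => ?_
    rw [Measure.map_apply hc.measurable hs, Measure.smul_apply]
    have h1 := Measure.isAddLeftInvariant_eq_smul μ (μH[Module.finrank ℝ E] : Measure E)
    rw [h1, Measure.smul_apply, Measure.smul_apply, ENNReal.smul_def, ENNReal.smul_def,
      ENNReal.smul_def, smul_eq_mul, smul_eq_mul, smul_eq_mul, mul_left_comm]
    gcongr
    simpa using hf.hausdorffMeasure_preimage_le (d := Module.finrank ℝ E) (by positivity) s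
  rw [← lintegral_map hh hc.measurable]
  refine (lintegral_mono' hle le_rfl).trans_eq ?_
  rw [lintegral_smul_measure, ENNReal.smul_def, smul_eq_mul, ENNReal.coe_pow]

theorem sq_lintegral_mul_le {α : Type*} [MeasurableSpace α] {μ : Measure α} {f g : α → ℝ≥0∞}
    (hf : AEMeasurable f μ) (hg : AEMeasurable g μ) :
    (∫⁻ x, f x * g x ∂μ) ^ 2 ≤ (∫⁻ x, f x ^ 2 ∂μ) * ∫⁻ x, g x ^ 2 ∂μ := by
  have h := ENNReal.lintegral_mul_le_Lp_mul_Lq μ (p := 2) (q := 2)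
    (Real.HolderConjugate.two_two) hf hg
  have hsq : ∀ a : ℝ≥0∞, (a ^ (1 / 2 : ℝ)) ^ 2 = a := fun a => by
    rw [← ENNReal.rpow_natCast, ← ENNReal.rpow_mul]; norm_num
  simp only [Pi.mul_apply, ENNReal.rpow_ofNat] at h
  calc _ ≤ _ := pow_le_pow_left' h 2
    _ = _ := by rw [mul_pow, hsq, hsq]

/-- Data for the convolution of densities `U`, `V` carried by two transversal graphs. -/
structure GraphConvData (φ₁ φ₂ : ℝ × ℝ → ℝ) (U V : ℝ × ℝ → ℂ) (D₁ D₂ : Set (ℝ × ℝ))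
    (a₁ a₂ : ℝ × ℝ → ℝ) : Prop where
  lip₁ : SmallLip φ₁
  lip₂ : SmallLip φ₂
  contU : Continuous U
  contV : Continuous V
  suppU : HasCompactSupport U
  suppV : HasCompactSupport V
  open₁ : IsOpen D₁
  open₂ : IsOpen D₂
  sub₁ : tsupport U ⊆ D₁
  sub₂ : tsupport V ⊆ D₂
  cont₁ : ContinuousOn a₁ D₁
  cont₂ : ContinuousOn a₂ D₂
  deriv₁ : ∀ p ∈ D₁, HasDerivAt (fun s => φ₁ (s, p.2)) (a₁ p) p.1
  deriv₂ : ∀ p ∈ D₂, HasDerivAt (fun s => φ₂ (s, p.2)) (a₂ p) p.1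

/-- The product density divided by the Jacobian of the sum map. -/
noncomputable def jacDensity (U V : ℝ × ℝ → ℂ) (a₁ a₂ : ℝ × ℝ → ℝ) (x : (ℝ × ℝ) × (ℝ × ℝ)) : ℂ :=
  U x.1 * V x.2 / ((1 - a₁ x.1 * a₂ x.2 : ℝ) : ℂ)

/-! ### The convolution density of two transversal graphs and its bound on a third one. -/

namespace GraphConvData

variable {φ₁ φ₂ : ℝ × ℝ → ℝ} {U V : ℝ × ℝ → ℂ} {D₁ D₂ : Set (ℝ × ℝ)} {a₁ a₂ : ℝ × ℝ → ℝ}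
  (hd : GraphConvData φ₁ φ₂ U V D₁ D₂ a₁ a₂)

include hd in
-- Both slopes are at most 1/8 in absolute value, so the Jacobian is at least `1 - 1/64`.
theorem half_le_jac {p q : ℝ × ℝ} (hp : p ∈ D₁) (hq : q ∈ D₂) : 1 / 2 ≤ 1 - a₁ p * a₂ q := by
  have e1 := hd.lip₁.abs_deriv_le (hd.deriv₁ p hp)
  have e2 := hd.lip₂.abs_deriv_le (hd.deriv₂ q hq)
  have : |a₁ p * a₂ q| ≤ 1 / 8 * (1 / 8) := by
    rw [abs_mul]; gcongr
  linarith [le_abs_self (a₁ p * a₂ q)]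

include hd in
theorem norm_jacDensity_le (x : (ℝ × ℝ) × (ℝ × ℝ)) :
    ‖jacDensity U V a₁ a₂ x‖ ≤ 2 * (‖U x.1‖ * ‖V x.2‖) := by
  unfold jacDensity
  by_cases hp : x.1 ∈ D₁
  · by_cases hq : x.2 ∈ D₂
    · have := hd.half_le_jac hp hq
      have hpos : 0 < 1 - a₁ x.1 * a₂ x.2 := by linarith
      rw [norm_div, norm_mul, Complex.norm_real, Real.norm_of_nonneg hpos.le,
        div_le_iff₀ hpos]
      nlinarith [mul_nonneg (norm_nonneg (U x.1)) (norm_nonneg (V x.2))]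
    · have : V x.2 = 0 := image_eq_zero_of_notMem_tsupport fun h => hq (hd.sub₂ h)
      simp [this]
  · have : U x.1 = 0 := image_eq_zero_of_notMem_tsupport fun h => hp (hd.sub₁ h)
    simp [this]

theorem jacDensity_eq_zero {x : (ℝ × ℝ) × (ℝ × ℝ)} (hx : x ∉ tsupport U ×ˢ tsupport V) :
    jacDensity U V a₁ a₂ x = 0 := by
  unfold jacDensity
  rw [mem_prod, not_and_or] at hx
  rcases hx with hx | hx
  · simp [image_eq_zero_of_notMem_tsupport hx]
  · simp [image_eq_zero_of_notMem_tsupport hx]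

include hd in
theorem continuous_jacDensity : Continuous (jacDensity U V a₁ a₂) := by
  rw [continuous_iff_continuousAt]
  intro x
  by_cases hx : x ∈ tsupport U ×ˢ tsupport V
  · have h1 : x.1 ∈ D₁ := hd.sub₁ hx.1
    have h2 : x.2 ∈ D₂ := hd.sub₂ hx.2
    have c1 : ContinuousAt (fun x : (ℝ × ℝ) × (ℝ × ℝ) => a₁ x.1) x :=
      (hd.cont₁.continuousAt (hd.open₁.mem_nhds h1)).comp continuousAt_fst
    have c2 : ContinuousAt (fun x : (ℝ × ℝ) × (ℝ × ℝ) => a₂ x.2) x :=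
      (hd.cont₂.continuousAt (hd.open₂.mem_nhds h2)).comp continuousAt_snd
    have c3 : Continuous fun x : (ℝ × ℝ) × (ℝ × ℝ) => U x.1 * V x.2 :=
      (hd.contU.comp continuous_fst).mul (hd.contV.comp continuous_snd)
    refine c3.continuousAt.div
      (Complex.continuous_ofReal.continuousAt.comp (continuousAt_const.sub (c1.mul c2))) ?_
    have := hd.half_le_jac h1 h2
    exact_mod_cast (by linarith : 0 < 1 - a₁ x.1 * a₂ x.2).ne'
  · have hcl : IsClosed (tsupport U ×ˢ tsupport V) :=
      (isClosed_tsupport U).prod (isClosed_tsupport V)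
    have : jacDensity U V a₁ a₂ =ᶠ[𝓝 x] fun _ => 0 := by
      filter_upwards [hcl.isOpen_compl.mem_nhds hx] with y hy using jacDensity_eq_zero hy
    exact continuousAt_const.congr this.symm

/-- The convolution density before integration over the fibre. -/
noncomputable def fibreDensity (p : ℝ × ((ℝ × ℝ) × ℝ)) : ℂ :=
  jacDensity U V a₁ a₂ (fibrePair hd.lip₁ hd.lip₂ p)

/-- A compact set carrying the fibre density. -/
def fibreSupport (φ₁ φ₂ : ℝ × ℝ → ℝ) (U V : ℝ × ℝ → ℂ) : Set (ℝ × ((ℝ × ℝ) × ℝ)) :=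
  graphSum φ₁ φ₂ '' (tsupport U ×ˢ tsupport V)

include hd in
theorem isCompact_fibreSupport : IsCompact (fibreSupport φ₁ φ₂ U V) :=
  (hd.suppU.isCompact.prod hd.suppV.isCompact).image (continuous_graphSum hd.lip₁ hd.lip₂)

theorem fibreDensity_eq_zero {p : ℝ × ((ℝ × ℝ) × ℝ)} (hp : p ∉ fibreSupport φ₁ φ₂ U V) :
    hd.fibreDensity p = 0 :=
  jacDensity_eq_zero fun h => hp ⟨_, h, graphSum_fibrePair _ _ p⟩

theorem continuous_fibreDensity : Continuous hd.fibreDensity :=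
  hd.continuous_jacDensity.comp (continuous_fibrePair _ _)

/-- The density of the convolution. -/
noncomputable def convDensity (z : (ℝ × ℝ) × ℝ) : ℂ := ∫ t, hd.fibreDensity (t, z)

theorem continuous_convDensity : Continuous hd.convDensity := by
  have hK := hd.isCompact_fibreSupport.image continuous_fst
  have : hd.convDensity =
      fun z => ∫ t in Prod.fst '' fibreSupport φ₁ φ₂ U V, hd.fibreDensity (t, z) := by
    ext z
    refine (setIntegral_eq_integral_of_forall_compl_eq_zero fun t ht => ?_).symm
    exact hd.fibreDensity_eq_zero fun h => ht ⟨_, h, rfl⟩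
  rw [this]
  refine continuous_parametric_integral_of_continuous
    (f := fun z t => hd.fibreDensity (t, z)) ?_ hK
  exact hd.continuous_fibreDensity.comp continuous_swap

theorem hasCompactSupport_convDensity : HasCompactSupport hd.convDensity := by
  refine HasCompactSupport.intro (hd.isCompact_fibreSupport.image continuous_snd) fun z hz => ?_
  rw [convDensity]
  simp_rw [fun t => hd.fibreDensity_eq_zero (p := (t, z)) fun h => hz ⟨_, h, rfl⟩]
  simp

/-- Change of variables along the fibre. -/
theorem integral_fibre (t : ℝ) (w : ℝ × ℝ) (ψ : (ℝ × ℝ) × ℝ → ℂ) :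
    ∫ s, U (s, t) * V (w.1 - φ₁ (s, t), w.2 - t) *
        ψ (w, s + φ₂ (w.1 - φ₁ (s, t), w.2 - t)) =
      ∫ z, hd.fibreDensity (t, (w, z)) * ψ (w, z) := by
  set A : Set ℝ := {s | (s, t) ∈ D₁ ∧ (w.1 - φ₁ (s, t), w.2 - t) ∈ D₂} with hA
  have hφ₁ := hd.lip₁.continuous
  have hAo : IsOpen A :=
    (hd.open₁.preimage (f := fun s : ℝ => (s, t)) (by fun_prop)).inter
      (hd.open₂.preimage (f := fun s : ℝ => (w.1 - φ₁ (s, t), w.2 - t)) (by fun_prop))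
  set m : ℝ → ℝ := fun s => s + φ₂ (w.1 - φ₁ (s, t), w.2 - t) with hm
  have hσ : ∀ s, fibrePair hd.lip₁ hd.lip₂ (t, (w, m s)) =
      ((s, t), (w.1 - φ₁ (s, t), w.2 - t)) := by
    intro s
    have : fibreParam hd.lip₁ hd.lip₂ (t, (w, m s)) = s := fibreParam_eq _ _ rfl
    simp [fibrePair, this]
  have hderiv : ∀ s ∈ A, HasDerivWithinAt m
      (1 - a₁ (s, t) * a₂ (w.1 - φ₁ (s, t), w.2 - t)) A s := by
    intro s hs
    have e1 := hd.deriv₁ _ hs.1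
    have e2 := hd.deriv₂ _ hs.2
    simp only at e1 e2
    have e3 := (hasDerivAt_id s).add (e2.comp s (e1.const_sub w.1))
    refine (e3.congr_deriv ?_).hasDerivWithinAt
    ring
  -- By `hσ` the parameter `s` is read off from `m s` as the first coordinate of the fibre pair.
  have hinj : InjOn m A := by
    intro s _ s' _ h
    have := congrArg (fun x => x.1.1) ((hσ s).symm.trans ((congrArg _ (by rw [h])).trans (hσ s')))
    exact this
  -- If the density at `z` is nonzero, the fibre parameter lies in `A` and is mapped to `z` by `m`;
  -- so the integral lives on `m '' A`, where the substitution `z = m s` applies.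
  have h1 : ∫ z, hd.fibreDensity (t, (w, z)) * ψ (w, z) =
      ∫ z in m '' A, hd.fibreDensity (t, (w, z)) * ψ (w, z) := by
    refine (setIntegral_eq_integral_of_forall_compl_eq_zero fun z hz => ?_).symm
    have : hd.fibreDensity (t, (w, z)) = 0 := by
      refine jacDensity_eq_zero fun h => hz ⟨fibreParam hd.lip₁ hd.lip₂ (t, (w, z)), ?_, ?_⟩
      · exact ⟨hd.sub₁ h.1, hd.sub₂ h.2⟩
      · exact fibreParam_spec _ _ t (w, z)
    rw [this, zero_mul]
  rw [h1, integral_image_eq_integral_abs_deriv_smul hAo.measurableSet hderiv hinj]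
  rw [← setIntegral_eq_integral_of_forall_compl_eq_zero (s := A)]
  · refine setIntegral_congr_fun hAo.measurableSet fun s hs => ?_
    have hj := hd.half_le_jac hs.1 hs.2
    have hpos : 0 < 1 - a₁ (s, t) * a₂ (w.1 - φ₁ (s, t), w.2 - t) := by linarith
    have hne : ((1 - a₁ (s, t) * a₂ (w.1 - φ₁ (s, t), w.2 - t) : ℝ) : ℂ) ≠ 0 := by
      exact_mod_cast hpos.ne'
    simp only [fibreDensity, hσ, jacDensity]
    rw [abs_of_pos hpos, Complex.real_smul]
    field_simp
    rfl
  · intro s hs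
    rw [hA, mem_ofPred_eq, not_and_or] at hs
    rcases hs with hs | hs
    · rw [image_eq_zero_of_notMem_tsupport fun h => hs (hd.sub₁ h)]; simp
    · rw [image_eq_zero_of_notMem_tsupport fun h => hs (hd.sub₂ h)]; simp

theorem integral_integral_mul_eq (ψ : (ℝ × ℝ) × ℝ → ℂ) (hψ : Continuous ψ) :
    ∫ p, ∫ q, U p * V q * ψ (graphSum φ₁ φ₂ (p, q)).2 = ∫ z, hd.convDensity z * ψ z := by
  have hφ₁ := hd.lip₁.continuous
  have hφ₂ := hd.lip₂.continuous
  have hU := hd.contU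
  have hV := hd.contV
  set A : ℝ × ℝ → ℝ × ℝ → ℂ := fun p w => U p * V (w.1 - φ₁ p, w.2 - p.2) *
    ψ (w, p.1 + φ₂ (w.1 - φ₁ p, w.2 - p.2)) with hA
  have hAc : Continuous (Function.uncurry A) := by
    simp only [hA, Function.uncurry_def]
    fun_prop
  have hAsupp : HasCompactSupport (Function.uncurry A) := by
    refine HasCompactSupport.intro (K := (fun x : (ℝ × ℝ) × (ℝ × ℝ) =>
      (x.1, (x.2.1 + φ₁ x.1, x.2.2 + x.1.2))) '' (tsupport U ×ˢ tsupport V))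
      ((hd.suppU.isCompact.prod hd.suppV.isCompact).image (by fun_prop)) fun x hx => ?_
    by_contra hne
    refine hx ⟨(x.1, (x.2.1 - φ₁ x.1, x.2.2 - x.1.2)), ⟨?_, ?_⟩, by simp⟩
    · by_contra h
      exact hne (by simp [Function.uncurry, hA, image_eq_zero_of_notMem_tsupport h])
    · by_contra h
      have h0 := image_eq_zero_of_notMem_tsupport h
      simp only at h0
      exact hne (by simp [Function.uncurry, hA, h0])
  -- Translating `q` by `(φ₁ p, p.2)` makes the first two coordinates of the sum independent
  -- variables `w`. Only the last coordinate then needs a nonlinear substitution.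
  have s1 : ∫ p, ∫ q, U p * V q * ψ (graphSum φ₁ φ₂ (p, q)).2 = ∫ p, ∫ w, A p w := by
    refine integral_congr_ae (Eventually.of_forall fun p => ?_)
    simp only
    rw [← integral_sub_right_eq_self _ ((φ₁ p, p.2) : ℝ × ℝ)]
    refine integral_congr_ae (Eventually.of_forall fun w => ?_)
    simp [graphSum, hA]
    rfl
  have s2 : ∫ p, ∫ w, A p w = ∫ w, ∫ p, A p w :=
    integral_integral_swap (hAc.integrable_of_hasCompactSupport hAsupp)
  have s3 : ∀ w, ∫ p, A p w = ∫ z, hd.convDensity (w, z) * ψ (w, z) := by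
    intro w
    have hAw : Integrable (fun p => A p w) := by
      refine Continuous.integrable_of_hasCompactSupport
        (hAc.comp (f := fun p : ℝ × ℝ => (p, w)) (by fun_prop)) ?_
      refine HasCompactSupport.intro hd.suppU.isCompact fun p hp => ?_
      simp [hA, image_eq_zero_of_notMem_tsupport hp]
    have hBc : Continuous (Function.uncurry fun t z : ℝ => hd.fibreDensity (t, (w, z)) * ψ (w, z)) := by
      refine (hd.continuous_fibreDensity.comp
        (f := fun x : ℝ × ℝ => (x.1, (w, x.2))) (by fun_prop)).mul (by fun_prop)
    have hBs : HasCompactSupport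
        (Function.uncurry fun t z : ℝ => hd.fibreDensity (t, (w, z)) * ψ (w, z)) := by
      refine HasCompactSupport.intro (hd.isCompact_fibreSupport.image
        (f := fun p : ℝ × ((ℝ × ℝ) × ℝ) => (p.1, p.2.2)) (by fun_prop)) fun x hx => ?_
      have : hd.fibreDensity (x.1, (w, x.2)) = 0 :=
        hd.fibreDensity_eq_zero fun h => hx ⟨_, h, rfl⟩
      simp [Function.uncurry, this]
    calc ∫ p, A p w = ∫ t, ∫ s, A (s, t) w := by
          rw [Measure.volume_eq_prod] at hAw ⊢
          exact integral_prod_symm _ hAw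
      _ = ∫ t, ∫ z, hd.fibreDensity (t, (w, z)) * ψ (w, z) :=
          integral_congr_ae (Eventually.of_forall fun t => hd.integral_fibre t w ψ)
      _ = ∫ z, ∫ t, hd.fibreDensity (t, (w, z)) * ψ (w, z) :=
          integral_integral_swap (hBc.integrable_of_hasCompactSupport hBs)
      _ = _ := by
          refine integral_congr_ae (Eventually.of_forall fun z => ?_)
          simp only [convDensity]
          rw [integral_mul_const]
  rw [s1, s2]
  simp_rw [s3]
  have hint : Integrable (fun z => hd.convDensity z * ψ z) :=
    (hd.continuous_convDensity.mul hψ).integrable_of_hasCompactSupport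
      hd.hasCompactSupport_convDensity.mul_right
  rw [Measure.volume_eq_prod] at hint ⊢
  exact (integral_prod _ hint).symm

/-- The trilinear estimate, in the form of a bound for the restriction of the convolution to a
third transversal graph. -/
theorem lintegral_convDensity_graph_le {φ₃ : ℝ × ℝ → ℝ} (h₃ : SmallLip φ₃) :
    ∫⁻ w : ℝ × ℝ, ‖hd.convDensity ((w.1, φ₃ w), w.2)‖ₑ ^ 2 ≤
      4 ^ 5 * ((∫⁻ p, ‖U p‖ₑ ^ 2) * ∫⁻ q, ‖V q‖ₑ ^ 2) := by
  have hφ₃ := h₃.continuous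
  have hU := hd.contU
  have hV := hd.contV
  have hpair := continuous_fibrePair hd.lip₁ hd.lip₂
  set P : ℝ × ℝ → ℝ → (ℝ × ℝ) × (ℝ × ℝ) :=
    fun w t => fibrePair hd.lip₁ hd.lip₂ (t, ((w.1, φ₃ w), w.2)) with hP
  have hPc : Continuous (fun x : (ℝ × ℝ) × ℝ => P x.1 x.2) :=
    hpair.comp (f := fun x : (ℝ × ℝ) × ℝ => (x.2, ((x.1.1, φ₃ x.1), x.1.2))) (by fun_prop)
  have hPw : ∀ w, Continuous (P w) := fun w => hPc.comp (f := fun t : ℝ => (w, t)) (by fun_prop)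
  have hpt : ∀ w : ℝ × ℝ, ‖hd.convDensity ((w.1, φ₃ w), w.2)‖ₑ ^ 2 ≤
      4 * ∫⁻ τ : ℝ × ℝ, ‖U (P w τ.1).1‖ₑ ^ 2 * ‖V (P w τ.2).2‖ₑ ^ 2 := by
    intro w
    have hPw' := hPw w
    have e1 : ‖hd.convDensity ((w.1, φ₃ w), w.2)‖ₑ ≤
        2 * ∫⁻ t, ‖U (P w t).1‖ₑ * ‖V (P w t).2‖ₑ := by
      rw [← lintegral_const_mul _ (by fun_prop)]
      refine (enorm_integral_le_lintegral_enorm _).trans (lintegral_mono fun t => ?_)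
      have := hd.norm_jacDensity_le (P w t)
      rw [← ofReal_norm, ← ofReal_norm, ← ofReal_norm, ← ENNReal.ofReal_mul (norm_nonneg _)]
      rw [show (2 : ℝ≥0∞) = ENNReal.ofReal 2 by simp, ← ENNReal.ofReal_mul (by norm_num)]
      exact ENNReal.ofReal_le_ofReal this
    -- Cauchy–Schwarz on the fibre. The two resulting integrals become one over `τ = (t, t')`, which
    -- supplies the two dimensions missing from `w`.
    have e2 : (∫⁻ t, ‖U (P w t).1‖ₑ * ‖V (P w t).2‖ₑ) ^ 2 ≤
        (∫⁻ t, ‖U (P w t).1‖ₑ ^ 2) * ∫⁻ t, ‖V (P w t).2‖ₑ ^ 2 :=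
      sq_lintegral_mul_le (by fun_prop) (by fun_prop)
    calc _ ≤ (2 * ∫⁻ t, ‖U (P w t).1‖ₑ * ‖V (P w t).2‖ₑ) ^ 2 := pow_le_pow_left' e1 2
      _ = 4 * (∫⁻ t, ‖U (P w t).1‖ₑ * ‖V (P w t).2‖ₑ) ^ 2 := by rw [mul_pow]; norm_num
      _ ≤ 4 * ((∫⁻ t, ‖U (P w t).1‖ₑ ^ 2) * ∫⁻ t, ‖V (P w t).2‖ₑ ^ 2) := by gcongr
      _ = _ := by
        rw [Measure.volume_eq_prod, lintegral_prod_mul (f := fun t => ‖U (P w t).1‖ₑ ^ 2)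
          (g := fun t => ‖V (P w t).2‖ₑ ^ 2) (by fun_prop) (by fun_prop)]
  have hmeas : Measurable fun x : (ℝ × ℝ) × (ℝ × ℝ) => ‖U x.1‖ₑ ^ 2 * ‖V x.2‖ₑ ^ 2 := by
    have h1 : Measurable fun p => ‖U p‖ₑ := hU.enorm.measurable
    have h2 : Measurable fun q => ‖V q‖ₑ := hV.enorm.measurable
    exact ((h1.comp measurable_fst).pow_const 2).mul ((h2.comp measurable_snd).pow_const 2)
  have : (volume : Measure ((ℝ × ℝ) × (ℝ × ℝ))).IsAddHaarMeasure :=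
    inferInstanceAs (((volume : Measure (ℝ × ℝ)).prod volume).IsAddHaarMeasure)
  have hmain := lintegral_comp_le_of_antilipschitz (volume : Measure ((ℝ × ℝ) × (ℝ × ℝ)))
    (antilipschitz_pairMap hd.lip₁ hd.lip₂ h₃) (continuous_pairMap _ _ h₃) hmeas
  have hfin : Module.finrank ℝ ((ℝ × ℝ) × (ℝ × ℝ)) = 4 := by simp
  rw [hfin] at hmain
  calc _ ≤ ∫⁻ w : ℝ × ℝ, 4 * ∫⁻ τ : ℝ × ℝ, ‖U (P w τ.1).1‖ₑ ^ 2 * ‖V (P w τ.2).2‖ₑ ^ 2 :=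
        lintegral_mono hpt
    _ = 4 * ∫⁻ w : ℝ × ℝ, ∫⁻ τ : ℝ × ℝ, ‖U (P w τ.1).1‖ₑ ^ 2 * ‖V (P w τ.2).2‖ₑ ^ 2 :=
        lintegral_const_mul' _ _ (by norm_num)
    _ = 4 * ∫⁻ x : (ℝ × ℝ) × (ℝ × ℝ), ‖U (pairMap hd.lip₁ hd.lip₂ φ₃ x).1‖ₑ ^ 2 *
          ‖V (pairMap hd.lip₁ hd.lip₂ φ₃ x).2‖ₑ ^ 2 := by
        rw [Measure.volume_eq_prod (ℝ × ℝ) (ℝ × ℝ), lintegral_prod]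
        · rfl
        · exact (hmeas.comp (continuous_pairMap _ _ h₃).measurable).aemeasurable
    _ ≤ 4 * ((4 : ℝ≥0) ^ 4 * ∫⁻ x : (ℝ × ℝ) × (ℝ × ℝ), ‖U x.1‖ₑ ^ 2 * ‖V x.2‖ₑ ^ 2) := by
        gcongr
    _ = _ := by
        rw [Measure.volume_eq_prod (ℝ × ℝ) (ℝ × ℝ),
          lintegral_prod_mul (f := fun p => ‖U p‖ₑ ^ 2) (g := fun q => ‖V q‖ₑ ^ 2)
            (by fun_prop) (by fun_prop), ← mul_assoc]
        norm_num

end GraphConvData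

/-! ### Hölder surfaces are locally transversal graphs -/

/-- The piece `P` of a surface is the graph of `φ` over the open set `D`, in the linear coordinates
`L` (tangential, normal), and its surface measure has density `w` in the coordinates of `D`. -/
structure GraphChart (P : Set R3) (L : R3 ≃L[ℝ] (ℝ × ℝ) × ℝ) (φ : ℝ × ℝ → ℝ) (D : Set (ℝ × ℝ))
    (φ' : ℝ × ℝ → ℝ × ℝ →L[ℝ] ℝ) (w : ℝ × ℝ → ℝ) (C : ℝ) : Prop where
  lip : SmallLip φ
  isOpen : IsOpen D
  image : (fun p => L.symm (p, φ p)) '' D = P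
  hasFDerivAt : ∀ p ∈ D, HasFDerivAt φ (φ' p) p
  continuousOn_deriv : ContinuousOn φ' D
  continuousOn_density : ContinuousOn w D
  density_nonneg : ∀ p, 0 ≤ w p
  density_le : ∀ p ∈ D, w p ≤ C
  measure : ((μHE[2] : Measure R3).restrict P).map (fun x => (L x).1) =
    (volume.restrict D).withDensity (fun p => ENNReal.ofReal (w p))

namespace IsHolderSurface

variable {β b : ℝ} {S S' U : Set R3} {Φ : R3 → ℝ} {n : R3 → R3}

theorem norm_normal_sub_le (h : IsHolderSurface β b S S' U Φ n) {x y : R3} (hx : x ∈ S')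
    (hy : y ∈ S') (hb : 0 ≤ b) : ‖n x - n y‖ ≤ b * dist x y ^ β := by
  rcases eq_or_ne x y with rfl | hne
  · simp only [sub_self, norm_zero]; positivity
  · have := h.holder x hx y hy hne
    have hd : 0 < dist x y := dist_pos.2 hne
    have h2 : 0 ≤ |inner ℝ (n x) (x - y)| / dist x y ^ (1 + β) := by positivity
    rw [← div_le_iff₀ (by positivity)]
    linarith

theorem abs_inner_le (h : IsHolderSurface β b S S' U Φ n) {x y : R3} (hx : x ∈ S')
    (hy : y ∈ S') (hb : 0 ≤ b) : |inner ℝ (n x) (x - y)| ≤ b * dist x y ^ (1 + β) := by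
  rcases eq_or_ne x y with rfl | hne
  · simp only [sub_self, inner_zero_right, abs_zero]; positivity
  · have := h.holder x hx y hy hne
    have hd : 0 < dist x y := dist_pos.2 hne
    have h2 : 0 ≤ ‖n x - n y‖ / dist x y ^ β := by positivity
    rw [← div_le_iff₀ (by positivity)]
    linarith

theorem continuousOn_normal (h : IsHolderSurface β b S S' U Φ n) (hβ : 0 < β) (hb : 0 ≤ b) :
    ContinuousOn n S' := by
  intro x hx
  rw [ContinuousWithinAt, tendsto_iff_norm_sub_tendsto_zero]
  have h0 : Tendsto (fun y => b * dist y x ^ β) (𝓝[S'] x) (𝓝 0) := by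
    have : Continuous fun y => b * dist y x ^ β :=
      continuous_const.mul ((continuous_id.dist continuous_const).rpow_const fun _ => Or.inr hβ.le)
    have := this.tendsto x
    simp only [dist_self, Real.zero_rpow hβ.ne', mul_zero] at this
    exact this.mono_left nhdsWithin_le_nhds
  refine squeeze_zero' (Eventually.of_forall fun _ => norm_nonneg _) ?_ h0
  filter_upwards [self_mem_nhdsWithin] with y hy using h.norm_normal_sub_le hy hx hb

theorem subset (h : IsHolderSurface β b S S' U Φ n) : S ⊆ S' := by
  obtain ⟨V, -, hV⟩ := h.relOpen
  rw [hV]; exact inter_subset_left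

theorem continuousOn_gradient (h : IsHolderSurface β b S S' U Φ n) : ContinuousOn (∇ Φ) U := by
  have := (h.regular.1.continuousOn_fderiv_of_isOpen h.isOpen_U le_rfl)
  exact (InnerProductSpace.toDual ℝ R3).symm.continuous.comp_continuousOn this

theorem hasStrictFDerivAt (h : IsHolderSurface β b S S' U Φ n) {x : R3} (hx : x ∈ U) :
    HasStrictFDerivAt Φ (fderiv ℝ Φ x) x :=
  (h.regular.1.contDiffAt (h.isOpen_U.mem_nhds hx)).hasStrictFDerivAt one_ne_zero

/-- A small piece of a Hölder surface varies little in the normal direction. -/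
theorem abs_inner_base_le (h : IsHolderSurface β b S S' U Φ n) (hβ : 0 < β) (hb : 0 ≤ b) {ρ : ℝ}
    {x₀ x y : R3} (hx₀ : x₀ ∈ S') (hx : x ∈ S') (hy : y ∈ S') (h1 : dist x x₀ ≤ ρ)
    (h2 : dist x y ≤ ρ) : |inner ℝ (n x₀) (x - y)| ≤ 2 * (b * ρ ^ β) * ‖x - y‖ := by
  have e1 := h.abs_inner_le hx hy hb
  have e2 := h.norm_normal_sub_le hx₀ hx hb
  rw [dist_comm] at e2
  have e3 : b * dist x x₀ ^ β ≤ b * ρ ^ β := by gcongr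
  have e4 : b * dist x y ^ β ≤ b * ρ ^ β := by gcongr
  have e5 : b * dist x y ^ (1 + β) = b * dist x y ^ β * ‖x - y‖ := by
    rw [Real.rpow_add_of_nonneg dist_nonneg zero_le_one hβ.le, Real.rpow_one, dist_eq_norm]; ring
  have e6 : inner ℝ (n x₀) (x - y) = inner ℝ (n x) (x - y) + inner ℝ (n x₀ - n x) (x - y) := by
    rw [inner_sub_left]; ring
  have e7 := abs_real_inner_le_norm (n x₀ - n x) (x - y)
  rw [e6]
  refine (abs_add_le _ _).trans ?_
  have e8 : ‖n x₀ - n x‖ * ‖x - y‖ ≤ b * ρ ^ β * ‖x - y‖ := by gcongr; linarith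
  have e9 : b * dist x y ^ β * ‖x - y‖ ≤ b * ρ ^ β * ‖x - y‖ := by gcongr
  linarith

theorem exists_graphChart (h : IsHolderSurface β b S S' U Φ n) (hβ : 0 < β) (hb : 0 ≤ b)
    {ρ K : ℝ} {O : Set R3} (hO : IsOpen O) (hOρ : ∀ x ∈ O, ∀ y ∈ O, dist x y ≤ ρ) {x₀ : R3}
    (hx₀ : x₀ ∈ S ∩ O) {L : R3 ≃L[ℝ] (ℝ × ℝ) × ℝ} (hL : ∀ x, (L x).2 = inner ℝ (n x₀) x)
    (hK : ∀ y, ‖L.symm y‖ ≤ K * ‖y‖) (hsmall : 2 * (b * ρ ^ β) * K ≤ 1 / 8) :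
    ∃ φ D φ' w, GraphChart (S ∩ O) L φ D φ' w (K ^ 2 * areaConst) := by
  set P := S ∩ O with hP
  have hPS : P ⊆ S' := inter_subset_left.trans h.subset
  have hPρ : ∀ x ∈ P, ∀ y ∈ P, dist x y ≤ ρ := fun x hx y hy => hOρ x hx.2 y hy.2
  have hρ0 : 0 ≤ ρ := dist_nonneg.trans (hPρ _ hx₀ _ hx₀)
  -- The bound is tested on a unit vector.
  have hK0 : 0 ≤ K := by
    have := (norm_nonneg _).trans (hK ((0, 0), 1))
    simpa [Prod.norm_def] using this
  have hη : 0 ≤ b * ρ ^ β := by positivity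
  -- the normal coordinate is a Lipschitz function of the tangential ones
  have hgraph : ∀ x ∈ P, ∀ y ∈ P, |(L x).2 - (L y).2| ≤ 1 / 8 * dist (L x).1 (L y).1 := by
    intro x hx y hy
    have e1 := h.abs_inner_base_le hβ hb (hPS hx₀) (hPS hx) (hPS hy) (hPρ _ hx _ hx₀)
      (hPρ _ hx _ hy)
    rw [inner_sub_right, ← hL, ← hL] at e1
    have e2 := hK (L (x - y))
    rw [L.symm_apply_apply] at e2
    have e3 : ‖L (x - y)‖ = max (dist (L x).1 (L y).1) |(L x).2 - (L y).2| := by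
      rw [map_sub, Prod.norm_def, dist_eq_norm, ← Real.norm_eq_abs]; rfl
    have e4 : |(L x).2 - (L y).2| ≤ 1 / 8 * ‖L (x - y)‖ := by
      refine e1.trans ?_
      calc _ ≤ 2 * (b * ρ ^ β) * (K * ‖L (x - y)‖) := by gcongr
        _ = 2 * (b * ρ ^ β) * K * ‖L (x - y)‖ := by ring
        _ ≤ _ := by gcongr
    rw [e3] at e4
    have hd : 0 ≤ dist (L x).1 (L y).1 := dist_nonneg
    -- If the normal difference were the larger one, it would be at most an eighth of itself, hence
    -- zero.
    rcases le_total (dist (L x).1 (L y).1) |(L x).2 - (L y).2| with hle | hle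
    · rw [max_eq_right hle] at e4
      have : |(L x).2 - (L y).2| ≤ 0 := by linarith
      linarith
    · rwa [max_eq_left hle] at e4
  set D : Set (ℝ × ℝ) := (fun x => (L x).1) '' P with hD
  obtain ⟨φ, hφlip, hφ⟩ : ∃ φ : ℝ × ℝ → ℝ, LipschitzWith (1 / 8) φ ∧
      ∀ x ∈ P, φ (L x).1 = (L x).2 := by
    have hmem : ∀ p ∈ D, Function.invFunOn (fun x => (L x).1) P p ∈ P :=
      fun p hp => Function.invFunOn_mem hp
    have heq : ∀ p ∈ D, (L (Function.invFunOn (fun x => (L x).1) P p)).1 = p :=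
      fun p hp => Function.invFunOn_eq (f := fun x => (L x).1) hp
    have hl : LipschitzOnWith (1 / 8)
        (fun p => (L (Function.invFunOn (fun x => (L x).1) P p)).2) D := by
      refine LipschitzOnWith.of_dist_le_mul fun p hp q hq => ?_
      have := hgraph _ (hmem p hp) _ (hmem q hq)
      rw [heq p hp, heq q hq] at this
      simpa [Real.dist_eq] using this
    -- The extension to the whole plane keeps the Lipschitz constant; the fixed-point argument for
    -- the fibre needs `φ` to be defined and Lipschitz everywhere.
    obtain ⟨φ, h1, h2⟩ := hl.extend_real
    refine ⟨φ, h1, fun x hx => ?_⟩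
    have hpD : (L x).1 ∈ D := mem_image_of_mem (fun x => (L x).1) hx
    rw [← h2 hpD]
    have := hgraph _ (hmem _ hpD) _ hx
    rw [heq _ hpD, dist_self, mul_zero] at this
    exact sub_eq_zero.1 (abs_nonpos_iff.1 this)
  have hsl : SmallLip φ := by
    intro p q
    have := hφlip.dist_le_mul p q
    rw [Real.dist_eq, Prod.dist_eq, Real.dist_eq, Real.dist_eq] at this
    refine this.trans ?_
    push_cast
    gcongr
    exact max_le (by linarith [abs_nonneg (p.2 - q.2)]) (by linarith [abs_nonneg (p.1 - q.1)])
  set G : ℝ × ℝ → R3 := fun p => L.symm (p, φ p) with hG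
  have hGL : ∀ x ∈ P, G (L x).1 = x := by
    intro x hx
    simp only [hG]
    rw [hφ x hx]
    exact L.symm_apply_apply x
  have hGP : ∀ p ∈ D, G p ∈ P := by
    rintro _ ⟨x, hx, rfl⟩
    simpa only [hGL x hx] using hx
  have hLG : ∀ p, (L (G p)).1 = p := fun p => by simp [hG]
  have himage : G '' D = P := by
    refine Subset.antisymm (image_subset_iff.2 hGP) fun x hx => ?_
    exact ⟨(L x).1, mem_image_of_mem (fun x => (L x).1) hx, hGL x hx⟩
  have hGdist : ∀ p q, ‖G p - G q‖ ≤ K * ‖p - q‖ := by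
    intro p q
    have e : G p - G q = L.symm (p - q, φ p - φ q) := by simp only [hG, ← map_sub]; rfl
    rw [e]
    refine (hK _).trans ?_
    gcongr
    rw [Prod.norm_def]
    refine max_le le_rfl ?_
    have := hφlip.dist_le_mul p q
    rw [dist_eq_norm, dist_eq_norm] at this
    refine this.trans ?_
    push_cast
    linarith [norm_nonneg (p - q)]
  -- transversality of the normal direction
  set d : R3 := L.symm ((0, 0), 1) with hd
  -- At the base point the product is 1, and moving to `x` changes it by at most `b ρ^β K ≤ 1/16`.
  have hν : ∀ x ∈ P, 1 / 2 ≤ inner ℝ (n x) d := by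
    intro x hx
    have e1 : inner ℝ (n x₀) d = 1 := by rw [← hL]; simp [hd]
    have e2 : ‖d‖ ≤ K := by simpa [Prod.norm_def] using hK ((0, 0), 1)
    have e3 := h.norm_normal_sub_le (hPS hx₀) (hPS hx) hb
    have e4 : b * dist x₀ x ^ β ≤ b * ρ ^ β := by
      have := hPρ _ hx₀ _ hx
      gcongr
    have e5 := (abs_le.1 (abs_real_inner_le_norm (n x₀ - n x) d)).2
    have e6 : ‖n x₀ - n x‖ * ‖d‖ ≤ b * ρ ^ β * K := by gcongr; linarith
    rw [inner_sub_left, e1] at e5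
    linarith
  -- Since `Φ` has nonzero derivative along `d`, the map `y ↦ ((L y).1, Φ y)` is a submersion and
  -- sends neighbourhoods onto neighbourhoods. Slicing at `Φ = 0` shows that all nearby tangential
  -- coordinates are attained on the piece.
  have hopen : IsOpen D := by
    rw [isOpen_iff_mem_nhds]
    rintro _ ⟨x, hx, rfl⟩
    have hxS := hPS hx
    have hxS' := hxS
    rw [h.zeroSet] at hxS'
    obtain ⟨hxU, hx0, hgrad⟩ := hxS'
    have hfd : fderiv ℝ Φ x d ≠ 0 := by
      obtain ⟨c, hc⟩ := h.normal x hxS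
      have e1 := hν x hx
      rw [hc, real_inner_smul_left] at e1
      have e2 : inner ℝ (∇ Φ x) d = fderiv ℝ Φ x d := by
        rw [gradient, InnerProductSpace.toDual_symm_apply]
      rw [e2] at e1
      intro h0
      rw [h0] at e1
      norm_num at e1
    set π : R3 →L[ℝ] ℝ × ℝ := (ContinuousLinearMap.fst ℝ (ℝ × ℝ) ℝ).comp
      (L : R3 →L[ℝ] (ℝ × ℝ) × ℝ) with hπ
    have hs : HasStrictFDerivAt (fun y => ((L y).1, Φ y)) (π.prod (fderiv ℝ Φ x)) x :=
      π.hasStrictFDerivAt.prodMk (h.hasStrictFDerivAt hxU)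
    have hsurj : (π.prod (fderiv ℝ Φ x)).range = ⊤ := by
      rw [LinearMap.range_eq_top]
      rintro ⟨v, c⟩
      refine ⟨L.symm (v, 0) + ((c - fderiv ℝ Φ x (L.symm (v, 0))) / fderiv ℝ Φ x d) • d, ?_⟩
      have e1 : π (L.symm (v, 0)) = v := by simp [hπ]
      have e2 : π d = 0 := by simp [hπ, hd]
      have e3 : ∀ y, (π.prod (fderiv ℝ Φ x) : R3 →ₗ[ℝ] (ℝ × ℝ) × ℝ) y =
        (π y, fderiv ℝ Φ x y) := fun y => rfl
      rw [e3, map_add, map_add, map_smul, map_smul, e1, e2, smul_zero, add_zero, smul_eq_mul,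
        div_mul_cancel₀ _ hfd, add_sub_cancel]
    have hmap := hs.map_nhds_eq_of_surj hsurj
    obtain ⟨V, hVo, hV⟩ := h.relOpen
    have hxV : x ∈ V := by
      have := hx.1
      rw [hV] at this
      exact this.2
    have hN : {y | y ∈ U ∧ ∇ Φ y ≠ 0 ∧ y ∈ V ∧ y ∈ O} ∈ 𝓝 x := by
      filter_upwards [h.isOpen_U.mem_nhds hxU, hVo.mem_nhds hxV, hO.mem_nhds hx.2,
        (h.continuousOn_gradient.continuousAt (h.isOpen_U.mem_nhds hxU)).eventually_ne hgrad]
        with y h1 h2 h3 h4 using ⟨h1, h4, h2, h3⟩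
    have hN2 := image_mem_map (m := fun y => ((L y).1, Φ y)) hN
    rw [hmap, hx0] at hN2
    have hcont : Tendsto (fun p : ℝ × ℝ => (p, (0 : ℝ))) (𝓝 (L x).1) (𝓝 ((L x).1, 0)) :=
      (by fun_prop : Continuous fun p : ℝ × ℝ => (p, (0 : ℝ))).tendsto _
    filter_upwards [hcont hN2] with p hp
    obtain ⟨y, ⟨hyU, hyg, hyV, hyO⟩, hy⟩ := hp
    rw [Prod.mk.injEq] at hy
    refine ⟨y, ⟨?_, hyO⟩, hy.1⟩
    rw [hV, h.zeroSet]
    exact ⟨⟨hyU, hy.2, hyg⟩, hyV⟩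
  -- differentiability
  set T : ℝ × ℝ →L[ℝ] R3 := (L.symm : (ℝ × ℝ) × ℝ →L[ℝ] R3).comp
    (ContinuousLinearMap.inl ℝ (ℝ × ℝ) ℝ) with hT
  set φ' : ℝ × ℝ → ℝ × ℝ →L[ℝ] ℝ := fun p =>
    (-(inner ℝ (n (G p)) d)⁻¹) • (innerSL ℝ (n (G p))).comp T with hφ'
  -- The remainder equals `-n(G p)·(G p - G q) / (n(G p)·d)`, so the second Hölder condition bounds
  -- it by a multiple of `‖q - p‖ ^ (1 + β)`.
  have hfd : ∀ p ∈ D, HasFDerivAt φ (φ' p) p := by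
    intro p hp
    have hνp := hν _ (hGP p hp)
    have hνpos : 0 < inner ℝ (n (G p)) d := by linarith
    rw [hasFDerivAt_iff_tendsto]
    have hlim : Tendsto (fun q => 2 * (b * K ^ (1 + β)) * ‖q - p‖ ^ β) (𝓝 p) (𝓝 0) := by
      have : Continuous fun q : ℝ × ℝ => 2 * (b * K ^ (1 + β)) * ‖q - p‖ ^ β :=
        continuous_const.mul ((by fun_prop : Continuous fun q : ℝ × ℝ => ‖q - p‖).rpow_const
          fun _ => Or.inr hβ.le)
      simpa [Real.zero_rpow hβ.ne'] using this.tendsto p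
    refine squeeze_zero' (Eventually.of_forall fun _ => by positivity) ?_ hlim
    filter_upwards [hopen.mem_nhds hp] with q hq
    have e1 : G p - G q = -(T (q - p) + (φ q - φ p) • d) := by
      simp only [hG, hT, hd, ← map_sub, ← map_smul, ContinuousLinearMap.comp_apply,
        ContinuousLinearEquiv.coe_coe, ← map_add, ← map_neg]
      congr 1
      ext <;> simp
    have e2 := h.abs_inner_le (hPS (hGP p hp)) (hPS (hGP q hq)) hb
    have e3 : φ q - φ p - φ' p (q - p) =
        -(inner ℝ (n (G p)) (G p - G q)) / inner ℝ (n (G p)) d := by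
      rw [e1, inner_neg_right, inner_add_right, real_inner_smul_right]
      simp only [hφ', _root_.smul_apply, ContinuousLinearMap.comp_apply, innerSL_apply_apply,
        smul_eq_mul]
      field_simp
      ring
    rw [dist_eq_norm] at e2
    have e4 : ‖φ q - φ p - φ' p (q - p)‖ ≤ 2 * (b * (K * ‖q - p‖) ^ (1 + β)) := by
      rw [e3, norm_div, norm_neg, Real.norm_eq_abs, Real.norm_of_nonneg hνpos.le, div_le_iff₀ hνpos]
      have e5 := hGdist p q
      rw [norm_sub_rev p] at e5
      have e6 : b * ‖G p - G q‖ ^ (1 + β) ≤ b * (K * ‖q - p‖) ^ (1 + β) := by gcongr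
      have e7 : 0 ≤ b * (K * ‖q - p‖) ^ (1 + β) := by positivity
      nlinarith
    rcases (norm_nonneg (q - p)).eq_or_lt with h0 | h0
    · rw [← h0]; simp [Real.zero_rpow hβ.ne']
    · rw [inv_mul_le_iff₀ h0]
      refine e4.trans_eq ?_
      rw [Real.mul_rpow hK0 (norm_nonneg _), Real.rpow_add h0 1 β, Real.rpow_one]
      ring
  have hGcont : ContinuousOn G D := by
    have : LipschitzWith K.toNNReal G := LipschitzWith.of_dist_le_mul fun p q => by
      rw [dist_eq_norm, dist_eq_norm, Real.coe_toNNReal _ hK0]; exact hGdist p q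
    exact this.continuous.continuousOn
  have hnG : ContinuousOn (fun p => n (G p)) D :=
    (h.continuousOn_normal hβ hb).comp hGcont fun p hp => hPS (hGP p hp)
  have hφ'c : ContinuousOn φ' D := by
    have hνc : ContinuousOn (fun p => (inner ℝ (n (G p)) d : ℝ)) D :=
      ContinuousOn.inner hnG continuousOn_const
    have hν0 : ∀ p ∈ D, (inner ℝ (n (G p)) d : ℝ) ≠ 0 := fun p hp => by
      have := hν _ (hGP p hp)
      linarith
    exact (hνc.inv₀ hν0).neg.smul
      (((innerSL ℝ).continuous.comp_continuousOn hnG).clm_comp continuousOn_const)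
  set G' : ℝ × ℝ → ℝ × ℝ →L[ℝ] R3 := fun p => (L.symm : (ℝ × ℝ) × ℝ →L[ℝ] R3).comp
    (ContinuousLinearMap.inl ℝ (ℝ × ℝ) ℝ + (ContinuousLinearMap.inr ℝ (ℝ × ℝ) ℝ).comp (φ' p))
    with hG'
  have hG'c : ContinuousOn G' D :=
    continuousOn_const.clm_comp (continuousOn_const.add (continuousOn_const.clm_comp hφ'c))
  have hG'd : ∀ p ∈ D, HasFDerivAt G (G' p) p := by
    intro p hp
    have e1 : HasFDerivAt (fun q => (q, φ q)) ((ContinuousLinearMap.id ℝ (ℝ × ℝ)).prod (φ' p)) p :=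
      (hasFDerivAt_id p).prodMk (hfd p hp)
    have e2 := (L.symm : (ℝ × ℝ) × ℝ →L[ℝ] R3).hasFDerivAt.comp p e1
    refine e2.congr_fderiv ?_
    refine ContinuousLinearMap.ext fun v => ?_
    change L.symm (v, φ' p v) = L.symm ((v, 0) + (0, φ' p v))
    simp
  have hGK : LipschitzOnWith K.toNNReal G D := LipschitzOnWith.of_dist_le_mul fun p _ q _ => by
    rw [dist_eq_norm, dist_eq_norm, Real.coe_toNNReal _ hK0]; exact hGdist p q
  have hG'K : ∀ p ∈ D, areaFactor (G' p) ≤ (K.toNNReal ^ 2 * areaConst : ℝ≥0) := by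
    intro p hp
    refine areaFactor_le ?_
    exact (hG'd p hp).le_of_lipschitzOn (hopen.mem_nhds hp) hGK
  have hmeas := map_restrict_euclideanHausdorffMeasure hopen (G := G) (G' := G')
    (π := (ContinuousLinearMap.fst ℝ (ℝ × ℝ) ℝ).comp (L : R3 →L[ℝ] (ℝ × ℝ) × ℝ))
    (fun p _ => hLG p) hG'd hG'c hGK
  have hpos : 0 < (‖(ContinuousLinearMap.fst ℝ (ℝ × ℝ) ℝ).comp (L : R3 →L[ℝ] (ℝ × ℝ) × ℝ)‖ + 1)⁻¹ :=
    by positivity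
  have hac : ContinuousOn (fun p => areaFactor (G' p)) D :=
    continuousOn_areaFactor hpos (fun p hp v => norm_le_of_leftInverse hopen
      (G := G) (fun p _ => hLG p) hp (hG'd p hp) v) hG'c
  refine ⟨φ, D, φ', fun p => (areaFactor (G' p)).toReal, hsl, hopen, himage, hfd, hφ'c, ?_,
    fun _ => ENNReal.toReal_nonneg, ?_, ?_⟩
  · intro p hp
    exact (ENNReal.tendsto_toReal (ne_top_of_le_ne_top ENNReal.coe_ne_top (hG'K p hp))).comp
      (hac p hp)
  · intro p hp
    have := ENNReal.toReal_mono ENNReal.coe_ne_top (hG'K p hp)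
    simpa [Real.coe_toNNReal _ hK0] using this
  · rw [← himage]
    refine Eq.trans hmeas (withDensity_congr_ae ?_)
    rw [Filter.EventuallyEq, ae_restrict_iff' hopen.measurableSet]
    refine Eventually.of_forall fun p hp => ?_
    exact (ENNReal.ofReal_toReal (ne_top_of_le_ne_top ENNReal.coe_ne_top (hG'K p hp))).symm

end IsHolderSurface

/-! ### Linear coordinates given by three transversal directions -/

/-- Cramer's rule: entries of unit vectors are at most 1 in absolute value, so the 2×2 minors are at
most 2, each coordinate of `x` is at most `6A/θ`, and the norm is at most the sum of the three. -/
theorem norm_le_of_abs_inner_le {n : Fin 3 → R3} (hn : ∀ i, ‖n i‖ = 1) {θ : ℝ} (hθ : 0 < θ)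
    (hdet : θ ≤ (Matrix.of fun k i : Fin 3 => n i k).det) {x : R3} {A : ℝ}
    (hA : ∀ i, |inner ℝ (n i) x| ≤ A) : ‖x‖ ≤ 18 / θ * A := by
  have hentry : ∀ i k, |n i k| ≤ 1 := fun i k => by
    have := PiLp.norm_apply_le (n i) k
    rwa [hn i, Real.norm_eq_abs] at this
  have hcof : ∀ i j k l, |n i k * n j l - n i l * n j k| ≤ 2 := by
    intro i j k l
    have e1 : |n i k * n j l| ≤ 1 := by
      rw [abs_mul]; exact mul_le_one₀ (hentry _ _) (abs_nonneg _) (hentry _ _)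
    have e2 : |n i l * n j k| ≤ 1 := by
      rw [abs_mul]; exact mul_le_one₀ (hentry _ _) (abs_nonneg _) (hentry _ _)
    exact (abs_sub _ _).trans (by linarith)
  have hA0 : 0 ≤ A := (abs_nonneg _).trans (hA 0)
  have hinner : ∀ i, inner ℝ (n i) x = n i 0 * x 0 + n i 1 * x 1 + n i 2 * x 2 := by
    intro i
    rw [PiLp.inner_apply, Fin.sum_univ_three]
    simp [mul_comm]
  set d := (Matrix.of fun k i : Fin 3 => n i k).det with hd
  have hdexp : d = n 0 0 * (n 1 1 * n 2 2 - n 1 2 * n 2 1) - n 0 1 * (n 1 0 * n 2 2 - n 1 2 * n 2 0)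
      + n 0 2 * (n 1 0 * n 2 1 - n 1 1 * n 2 0) := by
    rw [hd, Matrix.det_fin_three]
    simp only [Matrix.of_apply]
    ring
  have hx : ∀ k : Fin 3, |x k| ≤ 6 / θ * A := by
    have key : ∀ k l m : Fin 3, d * x k = inner ℝ (n 0) x * (n 1 l * n 2 m - n 1 m * n 2 l) +
        inner ℝ (n 1) x * (n 2 l * n 0 m - n 2 m * n 0 l) +
        inner ℝ (n 2) x * (n 0 l * n 1 m - n 0 m * n 1 l) → |x k| ≤ 6 / θ * A := by
      intro k l m h
      have hb : ∀ i j r, |inner ℝ (n r) x * (n i l * n j m - n i m * n j l)| ≤ A * 2 := by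
        intro i j r
        rw [abs_mul]
        exact mul_le_mul (hA r) (hcof _ _ _ _) (abs_nonneg _) hA0
      have h1 : |d * x k| ≤ 6 * A := by
        rw [h]
        refine (abs_add_three _ _ _).trans ?_
        linarith [hb 1 2 0, hb 2 0 1, hb 0 1 2]
      rw [abs_mul] at h1
      rw [div_mul_eq_mul_div, le_div_iff₀ hθ]
      have h2 : θ ≤ |d| := hdet.trans (le_abs_self _)
      nlinarith [abs_nonneg (x k)]
    intro k
    fin_cases k
    · refine key 0 1 2 ?_
      simp only [hinner, hdexp]; ring
    · refine key 1 2 0 ?_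
      simp only [hinner, hdexp]; ring
    · refine key 2 0 1 ?_
      simp only [hinner, hdexp]; ring
  have hsum : ‖x‖ ≤ |x 0| + |x 1| + |x 2| := by
    rw [EuclideanSpace.norm_eq, Real.sqrt_le_left (by positivity), Fin.sum_univ_three]
    simp only [Real.norm_eq_abs]
    nlinarith [abs_nonneg (x 0), abs_nonneg (x 1), abs_nonneg (x 2),
      mul_nonneg (abs_nonneg (x 0)) (abs_nonneg (x 1)),
      mul_nonneg (abs_nonneg (x 0)) (abs_nonneg (x 2)),
      mul_nonneg (abs_nonneg (x 1)) (abs_nonneg (x 2))]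
  have := hx 0
  have := hx 1
  have := hx 2
  calc ‖x‖ ≤ 6 / θ * A + 6 / θ * A + 6 / θ * A := by linarith
    _ = _ := by ring

theorem exists_coordinates {n : Fin 3 → R3} (hn : ∀ i, ‖n i‖ = 1) {θ : ℝ} (hθ : 0 < θ)
    (hdet : θ ≤ (Matrix.of fun k i : Fin 3 => n i k).det) (i j k : Fin 3)
    (hijk : ∀ m, m = i ∨ m = j ∨ m = k) :
    ∃ L : R3 ≃L[ℝ] (ℝ × ℝ) × ℝ,
      (∀ x, L x = ((inner ℝ (n i) x, inner ℝ (n j) x), inner ℝ (n k) x)) ∧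
      (∀ y, ‖L.symm y‖ ≤ 18 / θ * ‖y‖) ∧ ∀ x, ‖L x‖ ≤ ‖x‖ := by
  set ℓ : R3 →ₗ[ℝ] (ℝ × ℝ) × ℝ :=
    (((innerSL ℝ (n i) : R3 →L[ℝ] ℝ) : R3 →ₗ[ℝ] ℝ).prod
      ((innerSL ℝ (n j) : R3 →L[ℝ] ℝ) : R3 →ₗ[ℝ] ℝ)).prod
      ((innerSL ℝ (n k) : R3 →L[ℝ] ℝ) : R3 →ₗ[ℝ] ℝ) with hℓ
  have hℓx : ∀ x, ℓ x = ((inner ℝ (n i) x, inner ℝ (n j) x), inner ℝ (n k) x) := fun x => rfl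
  have hbound : ∀ x, ‖x‖ ≤ 18 / θ * ‖ℓ x‖ := by
    intro x
    refine norm_le_of_abs_inner_le hn hθ hdet fun m => ?_
    rw [hℓx, Prod.norm_def, Prod.norm_def]
    simp only [Real.norm_eq_abs]
    rcases hijk m with rfl | rfl | rfl
    · exact (le_max_left _ _).trans (le_max_left _ _)
    · exact (le_max_right _ _).trans (le_max_left _ _)
    · exact le_max_right _ _
  have hinj : Function.Injective ℓ := by
    rw [injective_iff_map_eq_zero]
    intro x hx
    have := hbound x
    rw [hx, norm_zero, mul_zero] at this
    exact norm_le_zero_iff.1 this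
  have hrank : Module.finrank ℝ R3 = Module.finrank ℝ ((ℝ × ℝ) × ℝ) := by simp
  set L := (LinearEquiv.ofInjectiveOfFinrankEq ℓ hinj hrank).toContinuousLinearEquiv
  have hLx : ∀ x, L x = ℓ x := fun x => rfl
  refine ⟨L, fun x => rfl, fun y => ?_, fun x => ?_⟩
  · have := hbound (L.symm y)
    rwa [← hLx, L.apply_symm_apply] at this
  · have hi : ∀ m, |inner ℝ (n m) x| ≤ ‖x‖ := fun m => by
      have := abs_real_inner_le_norm (n m) x
      rwa [hn, one_mul] at this
    rw [hLx, hℓx, Prod.norm_def, Prod.norm_def]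
    exact max_le (max_le (hi i) (hi j)) (hi k)

instance : (volume : Measure ((ℝ × ℝ) × ℝ)).IsAddHaarMeasure :=
  inferInstanceAs (((volume : Measure (ℝ × ℝ)).prod volume).IsAddHaarMeasure)

/-- A linear isomorphism of norm at most one onto coordinate space increases volume by at most a
universal factor. -/
theorem exists_volume_eq_smul_map : ∃ c₀ : ℝ≥0, ∀ L : R3 ≃L[ℝ] (ℝ × ℝ) × ℝ,
    (∀ x, ‖L x‖ ≤ ‖x‖) → ∃ c : ℝ≥0, c ≤ c₀ ∧
      (volume : Measure ((ℝ × ℝ) × ℝ)) = c • (volume : Measure R3).map L := by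
  have hfin2 : Module.finrank ℝ ((ℝ × ℝ) × ℝ) = 3 := by simp
  have i1 : (μH[(3 : ℕ)] : Measure R3).IsAddHaarMeasure := inferInstance
  have i2 : (μH[(3 : ℕ)] : Measure ((ℝ × ℝ) × ℝ)).IsAddHaarMeasure := by
    rw [← hfin2]; infer_instance
  obtain ⟨a, ha⟩ : ∃ a : ℝ≥0, (μH[(3 : ℕ)] : Measure R3) = a • volume :=
    ⟨_, Measure.isAddLeftInvariant_eq_smul _ _⟩
  obtain ⟨b, hb⟩ : ∃ b : ℝ≥0, (volume : Measure ((ℝ × ℝ) × ℝ)) = b • μH[(3 : ℕ)] :=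
    ⟨_, Measure.isAddLeftInvariant_eq_smul _ _⟩
  refine ⟨b * a, fun L hL => ?_⟩
  have i3 : ((volume : Measure R3).map L).IsAddHaarMeasure := L.isAddHaarMeasure_map _
  refine ⟨_, ?_, Measure.isAddLeftInvariant_eq_smul volume ((volume : Measure R3).map L)⟩
  set c := Measure.addHaarScalarFactor (volume : Measure ((ℝ × ℝ) × ℝ)) ((volume : Measure R3).map L)
  have hc : (volume : Measure ((ℝ × ℝ) × ℝ)) = c • (volume : Measure R3).map L :=
    Measure.isAddLeftInvariant_eq_smul _ _
  set B : Set ((ℝ × ℝ) × ℝ) := closedBall 0 1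
  have hB0 : (volume : Measure R3).map L B ≠ 0 := (measure_closedBall_pos _ _ one_pos).ne'
  have hB1 : (volume : Measure R3).map L B ≠ ⊤ := measure_closedBall_lt_top.ne
  -- Three-dimensional Hausdorff measure does not grow under the 1-Lipschitz map `L`. The factors
  -- `a` and `b` between Hausdorff and Lebesgue measure were fixed before `L`.
  have h1 : (volume : Measure ((ℝ × ℝ) × ℝ)) B ≤
      ((b * a : ℝ≥0) : ℝ≥0∞) * (volume : Measure R3).map L B := by
    have hlip : LipschitzWith 1 L := LipschitzWith.of_dist_le_mul fun x y => by
      rw [dist_eq_norm, dist_eq_norm, ← map_sub, NNReal.coe_one, one_mul]; exact hL _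
    have h2 := hlip.hausdorffMeasure_image_le (d := (3 : ℕ)) (by positivity) (L ⁻¹' B)
    rw [image_preimage_eq _ L.surjective, ENNReal.coe_one, ENNReal.one_rpow, one_mul, ha] at h2
    rw [hb, Measure.smul_apply, Measure.map_apply L.continuous.measurable measurableSet_closedBall,
      ENNReal.smul_def, smul_eq_mul, ENNReal.coe_mul, mul_assoc]
    gcongr
    rwa [Measure.smul_apply, ENNReal.smul_def, smul_eq_mul] at h2
  rw [hc, Measure.smul_apply, ENNReal.smul_def, smul_eq_mul, ENNReal.mul_le_mul_iff_left hB0 hB1]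
    at h1
  exact_mod_cast h1

/-- A universal constant for the change of variables to transversal coordinates. -/
noncomputable def coordConst : ℝ≥0 := exists_volume_eq_smul_map.choose

theorem exists_integral_comp_coordinates {L : R3 ≃L[ℝ] (ℝ × ℝ) × ℝ} (hL : ∀ x, ‖L x‖ ≤ ‖x‖) :
    ∃ c : ℝ≥0, c ≤ coordConst ∧ ∀ f : (ℝ × ℝ) × ℝ → ℂ, ∫ z, f z = ∫ x, (c : ℝ) • f (L x) := by
  obtain ⟨c, hc, h⟩ := exists_volume_eq_smul_map.choose_spec L hL
  refine ⟨c, hc, fun f => ?_⟩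
  have hmap : ∫ z, f z ∂(volume : Measure R3).map L = ∫ x, f (L x) :=
    L.toHomeomorph.measurableEmbedding.integral_map f
  rw [h, integral_smul_nnreal_measure, integral_smul, hmap]
  rfl

/-! ### Integration in a chart and the local convolution estimate -/

namespace GraphChart

variable {P : Set R3} {L : R3 ≃L[ℝ] (ℝ × ℝ) × ℝ} {φ : ℝ × ℝ → ℝ} {D : Set (ℝ × ℝ)}
  {φ' : ℝ × ℝ → ℝ × ℝ →L[ℝ] ℝ} {w : ℝ × ℝ → ℝ} {C : ℝ}

/-- The density of `u` in the chart. -/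
noncomputable def pull (L : R3 ≃L[ℝ] (ℝ × ℝ) × ℝ) (φ : ℝ × ℝ → ℝ) (D : Set (ℝ × ℝ))
    (w : ℝ × ℝ → ℝ) (u : R3 → ℂ) : ℝ × ℝ → ℂ :=
  D.indicator fun p => (w p : ℂ) * u (L.symm (p, φ p))

theorem continuous_param (hc : GraphChart P L φ D φ' w C) :
    Continuous fun p => L.symm (p, φ p) := by
  have := hc.lip.continuous
  fun_prop

theorem param_mem (hc : GraphChart P L φ D φ' w C) {p : ℝ × ℝ} (hp : p ∈ D) :
    L.symm (p, φ p) ∈ P := by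
  rw [← hc.image]
  exact mem_image_of_mem (fun p => L.symm (p, φ p)) hp

theorem param_fst (hc : GraphChart P L φ D φ' w C) {x : R3} (hx : x ∈ P) :
    (L x).1 ∈ D ∧ L.symm ((L x).1, φ (L x).1) = x := by
  rw [← hc.image] at hx
  obtain ⟨p, hp, rfl⟩ := hx
  simpa using hp

/-- A continuous injective image of a Borel set is Borel. -/
theorem measurableSet (hc : GraphChart P L φ D φ' w C) : MeasurableSet P := by
  rw [← hc.image]
  refine hc.isOpen.measurableSet.image_of_continuousOn_injOn hc.continuous_param.continuousOn ?_
  intro p _ q _ h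
  have := congrArg (fun x => (L x).1) h
  simpa using this

theorem exists_compact_support (hc : GraphChart P L φ D φ' w C) {u : R3 → ℂ} (hu : IsCcOn P u) :
    ∃ K : Set (ℝ × ℝ), IsCompact K ∧ K ⊆ D ∧ ∀ p ∉ K, pull L φ D w u p = 0 := by
  obtain ⟨-, K, hK, hKP, hK0⟩ := hu
  refine ⟨(fun x => (L x).1) '' K, hK.image (by fun_prop), ?_, fun p hp => ?_⟩
  · rintro _ ⟨x, hx, rfl⟩
    exact (hc.param_fst (hKP hx)).1
  · by_cases hpD : p ∈ D
    · rw [pull, indicator_of_mem hpD, hK0, mul_zero]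
      exact fun h => hp ⟨_, h, by simp⟩
    · rw [pull, indicator_of_notMem hpD]

theorem hasCompactSupport_pull (hc : GraphChart P L φ D φ' w C) {u : R3 → ℂ} (hu : IsCcOn P u) :
    HasCompactSupport (pull L φ D w u) := by
  obtain ⟨K, hK, -, h0⟩ := hc.exists_compact_support hu
  exact HasCompactSupport.intro hK fun p hp => h0 p hp

theorem tsupport_pull_subset (hc : GraphChart P L φ D φ' w C) {u : R3 → ℂ} (hu : IsCcOn P u) :
    tsupport (pull L φ D w u) ⊆ D := by
  obtain ⟨K, hK, hKD, h0⟩ := hc.exists_compact_support hu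
  refine (closure_minimal (fun p hp => ?_) hK.isClosed).trans hKD
  by_contra h
  exact hp (h0 p h)

theorem continuous_pull (hc : GraphChart P L φ D φ' w C) {u : R3 → ℂ} (hu : IsCcOn P u) :
    Continuous (pull L φ D w u) := by
  rw [continuous_iff_continuousAt]
  intro p
  by_cases hp : p ∈ tsupport (pull L φ D w u)
  · have hpD := hc.tsupport_pull_subset hu hp
    have hcont : ContinuousOn (fun p => (w p : ℂ) * u (L.symm (p, φ p))) D :=
      (Complex.continuous_ofReal.comp_continuousOn hc.continuousOn_density).mul
        (hu.1.comp hc.continuous_param.continuousOn fun p hp => hc.param_mem hp)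
    refine (hcont.continuousAt (hc.isOpen.mem_nhds hpD)).congr ?_
    filter_upwards [hc.isOpen.mem_nhds hpD] with q hq
    rw [pull, indicator_of_mem hq]
  · have : pull L φ D w u =ᶠ[𝓝 p] fun _ => 0 := by
      filter_upwards [(isClosed_tsupport _).isOpen_compl.mem_nhds hp] with q hq
        using image_eq_zero_of_notMem_tsupport hq
    exact continuousAt_const.congr this.symm

theorem aemeasurable_density (hc : GraphChart P L φ D φ' w C) :
    AEMeasurable w (volume.restrict D) :=
  hc.continuousOn_density.aemeasurable hc.isOpen.measurableSet

/-- On `P` every function factors through the tangential coordinates, so its integral is one against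
the push-forward of the surface measure. -/
theorem lintegral_eq (hc : GraphChart P L φ D φ' w C) {f : R3 → ℝ≥0∞}
    (hf : AEMeasurable (fun p => f (L.symm (p, φ p))) (volume.restrict D)) :
    ∫⁻ x, f x ∂surfaceMeasure P =
      ∫⁻ p in D, ENNReal.ofReal (w p) * f (L.symm (p, φ p)) := by
  have hπ : Continuous fun x => (L x).1 := by fun_prop
  have h1 : ∫⁻ x, f x ∂surfaceMeasure P =
      ∫⁻ x, (fun p => f (L.symm (p, φ p))) (L x).1 ∂surfaceMeasure P :=
    setLIntegral_congr_fun hc.measurableSet fun x hx => by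
      simp only [(hc.param_fst hx).2]
  rw [h1, surfaceMeasure, ← lintegral_map' (f := fun p => f (L.symm (p, φ p)))
      (g := fun x => (L x).1) _ hπ.measurable.aemeasurable, hc.measure,
    lintegral_withDensity_eq_lintegral_mul₀ hc.aemeasurable_density.ennreal_ofReal hf]
  · rfl
  · rw [hc.measure]
    exact hf.mono_ac (withDensity_absolutelyContinuous _ _)

theorem integral_eq (hc : GraphChart P L φ D φ' w C) {f : R3 → ℂ}
    (hf : AEStronglyMeasurable (fun p => f (L.symm (p, φ p))) (volume.restrict D)) :
    ∫ x, f x ∂surfaceMeasure P = ∫ p in D, (w p : ℂ) * f (L.symm (p, φ p)) := by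
  have hπ : Continuous fun x => (L x).1 := by fun_prop
  have h1 : ∫ x, f x ∂surfaceMeasure P =
      ∫ x, (fun p => f (L.symm (p, φ p))) (L x).1 ∂surfaceMeasure P :=
    setIntegral_congr_fun hc.measurableSet fun x hx => by
      simp only [(hc.param_fst hx).2]
  rw [h1, surfaceMeasure, ← integral_map (f := fun p => f (L.symm (p, φ p))) (φ := fun x => (L x).1)
      hπ.measurable.aemeasurable, hc.measure,
    integral_withDensity_eq_integral_toReal_smul₀ hc.aemeasurable_density.ennreal_ofReal
      (Eventually.of_forall fun _ => ENNReal.ofReal_lt_top)]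
  · refine integral_congr_ae (Eventually.of_forall fun p => ?_)
    simp only
    rw [ENNReal.toReal_ofReal (hc.density_nonneg p), Complex.real_smul]
  · rw [hc.measure]
    exact hf.mono_ac (withDensity_absolutelyContinuous _ _)

theorem aestronglyMeasurable_comp (hc : GraphChart P L φ D φ' w C) {f : R3 → ℂ}
    (hf : ContinuousOn f P) :
    AEStronglyMeasurable (fun p => f (L.symm (p, φ p))) (volume.restrict D) :=
  (hf.comp hc.continuous_param.continuousOn fun _ hp => hc.param_mem hp).aestronglyMeasurable
    hc.isOpen.measurableSet

theorem integral_mul_eq (hc : GraphChart P L φ D φ' w C) {u g : R3 → ℂ} (hu : IsCcOn P u)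
    (hg : Continuous g) :
    ∫ x, u x * g x ∂surfaceMeasure P = ∫ p, pull L φ D w u p * g (L.symm (p, φ p)) := by
  rw [hc.integral_eq (f := fun x => u x * g x) (hc.aestronglyMeasurable_comp (hu.1.mul hg.continuousOn)),
    ← integral_indicator hc.isOpen.measurableSet]
  refine integral_congr_ae (Eventually.of_forall fun p => ?_)
  by_cases hp : p ∈ D
  · simp only [pull, indicator_of_mem hp, mul_assoc]
  · simp only [pull, indicator_of_notMem hp, zero_mul]

/-- In `w² |u|²` one factor `w` is the surface density and the other is bounded by `C`. -/
theorem lintegral_pull_le (hc : GraphChart P L φ D φ' w C) {u : R3 → ℂ} (hu : IsCcOn P u) :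
    ∫⁻ p, ‖pull L φ D w u p‖ₑ ^ 2 ≤
      ENNReal.ofReal C * ∫⁻ x, ‖u x‖ₑ ^ 2 ∂surfaceMeasure P := by
  have hm := ((hc.aestronglyMeasurable_comp hu.1).enorm.pow_const 2)
  rw [hc.lintegral_eq (f := fun x => ‖u x‖ₑ ^ 2) hm, ← lintegral_const_mul' _ _ ENNReal.ofReal_ne_top,
    ← lintegral_indicator hc.isOpen.measurableSet]
  refine lintegral_mono fun p => ?_
  by_cases hp : p ∈ D
  · simp only [pull, indicator_of_mem hp]
    rw [enorm_mul, mul_pow, sq ‖(w p : ℂ)‖ₑ, mul_assoc]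
    have e : ‖(w p : ℂ)‖ₑ = ENNReal.ofReal (w p) := by
      rw [← ofReal_norm, Complex.norm_real, Real.norm_of_nonneg (hc.density_nonneg p)]
    rw [e]
    gcongr
    exact hc.density_le p hp
  · simp [pull, indicator_of_notMem hp]

theorem lintegral_le (hc : GraphChart P L φ D φ' w C) {f : R3 → ℝ≥0∞} (hf : Measurable f) :
    ∫⁻ x, f x ∂surfaceMeasure P ≤ ENNReal.ofReal C * ∫⁻ p, f (L.symm (p, φ p)) := by
  rw [hc.lintegral_eq (hf.comp hc.continuous_param.measurable).aemeasurable,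
    ← lintegral_const_mul' _ _ ENNReal.ofReal_ne_top]
  refine (setLIntegral_mono' hc.isOpen.measurableSet fun p hp => ?_).trans (setLIntegral_le_lintegral _ _)
  gcongr
  exact hc.density_le p hp

theorem hasDerivAt_fst (hc : GraphChart P L φ D φ' w C) {p : ℝ × ℝ} (hp : p ∈ D) :
    HasDerivAt (fun s => φ (s, p.2)) (φ' p (1, 0)) p.1 := by
  have h1 : HasDerivAt (fun s : ℝ => (s, p.2)) ((1, 0) : ℝ × ℝ) p.1 :=
    (hasDerivAt_id p.1).prodMk (hasDerivAt_const p.1 p.2)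
  exact (hc.hasFDerivAt p hp).comp_hasDerivAt p.1 h1

end GraphChart

/-- The convolution estimate for three pieces of surfaces which are transversal graphs. -/
theorem exists_conv_of_graphCharts {P : Fin 3 → Set R3} {L : Fin 3 → R3 ≃L[ℝ] (ℝ × ℝ) × ℝ}
    {φ : Fin 3 → ℝ × ℝ → ℝ} {D : Fin 3 → Set (ℝ × ℝ)} {φ' : Fin 3 → ℝ × ℝ → ℝ × ℝ →L[ℝ] ℝ}
    {w : Fin 3 → ℝ × ℝ → ℝ} {C : ℝ} (hc : ∀ i, GraphChart (P i) (L i) (φ i) (D i) (φ' i) (w i) C)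
    (hL : ‖(L 1 : R3 →L[ℝ] (ℝ × ℝ) × ℝ)‖ ≤ 1)
    (hL0 : ∀ x, L 0 x = (((L 1 x).2, (L 1 x).1.2), (L 1 x).1.1))
    (hL2 : ∀ x, L 2 x = (((L 1 x).1.1, (L 1 x).2), (L 1 x).1.2))
    {u v : R3 → ℂ} (hu : IsCcOn (P 0) u) (hv : IsCcOn (P 1) v) :
    ∃ F, IsContinuousConv (P 0) (P 1) u v F ∧
      ∫⁻ x, ‖F x‖ₑ ^ 2 ∂surfaceMeasure (P 2) ≤
        ENNReal.ofReal (coordConst ^ 2 * 4 ^ 5 * C ^ 3) *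
          ((∫⁻ x, ‖u x‖ₑ ^ 2 ∂surfaceMeasure (P 0)) * ∫⁻ x, ‖v x‖ₑ ^ 2 ∂surfaceMeasure (P 1)) := by
  have hLn : ∀ x, ‖L 1 x‖ ≤ ‖x‖ := fun x => by
    have := (L 1 : R3 →L[ℝ] (ℝ × ℝ) × ℝ).le_opNorm x
    refine this.trans ?_
    nlinarith [norm_nonneg x]
  obtain ⟨c, hcc, hint⟩ := exists_integral_comp_coordinates hLn
  set U := GraphChart.pull (L 0) (φ 0) (D 0) (w 0) u with hU
  set V := GraphChart.pull (L 1) (φ 1) (D 1) (w 1) v with hV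
  have hUc : Continuous U := (hc 0).continuous_pull hu
  have hVc : Continuous V := (hc 1).continuous_pull hv
  have hd : GraphConvData (φ 0) (φ 1) U V (D 0) (D 1) (fun p => φ' 0 p (1, 0))
      (fun p => φ' 1 p (1, 0)) :=
    { lip₁ := (hc 0).lip
      lip₂ := (hc 1).lip
      contU := hUc
      contV := hVc
      suppU := (hc 0).hasCompactSupport_pull hu
      suppV := (hc 1).hasCompactSupport_pull hv
      open₁ := (hc 0).isOpen
      open₂ := (hc 1).isOpen
      sub₁ := (hc 0).tsupport_pull_subset hu
      sub₂ := (hc 1).tsupport_pull_subset hv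
      cont₁ := (hc 0).continuousOn_deriv.clm_apply continuousOn_const
      cont₂ := (hc 1).continuousOn_deriv.clm_apply continuousOn_const
      deriv₁ := fun p hp => (hc 0).hasDerivAt_fst hp
      deriv₂ := fun p hp => (hc 1).hasDerivAt_fst hp }
  set F : R3 → ℂ := fun x => (c : ℝ) • hd.convDensity (L 1 x) with hF
  have hFc : Continuous F := by
    have := hd.continuous_convDensity
    exact (this.comp (L 1).continuous).const_smul (c : ℝ)
  refine ⟨F, ⟨hFc, fun ψ hψ _ => ?_⟩, ?_⟩
  · have hψc : Continuous ψ := hψ.continuous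
    -- By `hL0` the charts of the first two pieces use the same three coordinates in different
    -- order, and `graphSum` performs the addition in the order of `L 1`.
    have hsum : ∀ p q, (L 1).symm (graphSum (φ 0) (φ 1) (p, q)).2 =
        (L 0).symm (p, φ 0 p) + (L 1).symm (q, φ 1 q) := by
      intro p q
      rw [ContinuousLinearEquiv.symm_apply_eq, map_add, ContinuousLinearEquiv.apply_symm_apply]
      have h0 := hL0 ((L 0).symm (p, φ 0 p))
      rw [ContinuousLinearEquiv.apply_symm_apply, Prod.ext_iff, Prod.ext_iff] at h0
      obtain ⟨⟨e1, e2⟩, e3⟩ := h0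
      simp only at e1 e2 e3
      ext
      · simp [graphSum, ← e3]
      · simp [graphSum, ← e2]
      · simp [graphSum, ← e1]
    have hg : ∀ x, ∫ y, v y * ψ (x + y) ∂surfaceMeasure (P 1) =
        ∫ q, V q * ψ (x + (L 1).symm (q, φ 1 q)) := fun x =>
      (hc 1).integral_mul_eq (g := fun y => ψ (x + y)) hv (by fun_prop)
    have hgc : Continuous fun x => ∫ y, v y * ψ (x + y) ∂surfaceMeasure (P 1) := by
      simp_rw [hg]
      have : (fun x => ∫ q, V q * ψ (x + (L 1).symm (q, φ 1 q))) =
          fun x => ∫ q in tsupport V, V q * ψ (x + (L 1).symm (q, φ 1 q)) := by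
        ext x
        refine (setIntegral_eq_integral_of_forall_compl_eq_zero fun q hq => ?_).symm
        rw [image_eq_zero_of_notMem_tsupport hq, zero_mul]
      rw [this]
      have hp := (hc 1).continuous_param
      exact continuous_parametric_integral_of_continuous
        (f := fun x q => V q * ψ (x + (L 1).symm (q, φ 1 q)))
        ((hVc.comp continuous_snd).mul (hψc.comp
          (continuous_fst.add (hp.comp continuous_snd)))) hd.suppV.isCompact
    calc ∫ z, F z * ψ z = ∫ z, (c : ℝ) • (hd.convDensity (L 1 z) * ψ ((L 1).symm (L 1 z))) := by
          refine integral_congr_ae (Eventually.of_forall fun z => ?_)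
          simp [hF, mul_assoc]
      _ = ∫ z, hd.convDensity z * ψ ((L 1).symm z) := 
          (hint fun z => hd.convDensity z * ψ ((L 1).symm z)).symm
      _ = ∫ p, ∫ q, U p * V q * ψ ((L 1).symm (graphSum (φ 0) (φ 1) (p, q)).2) :=
          (hd.integral_integral_mul_eq (fun z => ψ ((L 1).symm z)) (by fun_prop)).symm
      _ = ∫ p, U p * ∫ y, v y * ψ ((L 0).symm (p, φ 0 p) + y) ∂surfaceMeasure (P 1) := by
          refine integral_congr_ae (Eventually.of_forall fun p => ?_)
          simp only [hsum, hg, mul_assoc]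
          rw [integral_const_mul]
      _ = ∫ x, u x * ∫ y, v y * ψ (x + y) ∂surfaceMeasure (P 1) ∂surfaceMeasure (P 0) :=
          ((hc 0).integral_mul_eq hu hgc).symm
      _ = surfaceConv (P 0) (P 1) u v ψ := by
          simp only [surfaceConv, mul_assoc]
          refine integral_congr_ae (Eventually.of_forall fun x => ?_)
          simp only
          rw [integral_const_mul]
  · have hC0 : 0 ≤ C ∨ D 2 = ∅ := by
      rcases (D 2).eq_empty_or_nonempty with h | ⟨p, hp⟩
      · exact Or.inr h
      · exact Or.inl (((hc 2).density_nonneg p).trans ((hc 2).density_le p hp))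
    rcases hC0 with hC0 | hD
    swap
    · have : P 2 = ∅ := by rw [← (hc 2).image, hD, image_empty]
      rw [this]
      simp [surfaceMeasure]
    have hFG : ∀ p, F ((L 2).symm (p, φ 2 p)) =
        (c : ℝ) • hd.convDensity ((p.1, φ 2 p), p.2) := by
      intro p
      have h2 := hL2 ((L 2).symm (p, φ 2 p))
      rw [ContinuousLinearEquiv.apply_symm_apply, Prod.ext_iff, Prod.ext_iff] at h2
      obtain ⟨⟨e1, e2⟩, e3⟩ := h2
      simp only at e1 e2 e3
      simp only [hF]
      congr 2
      ext
      · exact e1.symm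
      · exact e3.symm
      · exact e2.symm
    -- One factor `C` comes from the measure on the third piece and one from each of the two
    -- pulled-back densities; `coordConst` is squared because `F` carries it once.
    have hCe : ENNReal.ofReal (coordConst ^ 2 * 4 ^ 5 * C ^ 3) =
        ENNReal.ofReal C *
          ((coordConst : ℝ≥0∞) ^ 2 * (4 ^ 5 * (ENNReal.ofReal C * ENNReal.ofReal C))) := by
      rw [ENNReal.ofReal_mul (by positivity), ENNReal.ofReal_mul (by positivity),
        ENNReal.ofReal_pow (by positivity), ENNReal.ofReal_coe_nnreal, ENNReal.ofReal_pow hC0,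
        ENNReal.ofReal_pow (by norm_num)]
      norm_num
      ring
    calc ∫⁻ x, ‖F x‖ₑ ^ 2 ∂surfaceMeasure (P 2)
        ≤ ENNReal.ofReal C * ∫⁻ p, ‖F ((L 2).symm (p, φ 2 p))‖ₑ ^ 2 :=
          (hc 2).lintegral_le (f := fun x => ‖F x‖ₑ ^ 2) (hFc.enorm.measurable.pow_const 2)
      _ = ENNReal.ofReal C * ((c : ℝ≥0∞) ^ 2 *
            ∫⁻ p : ℝ × ℝ, ‖hd.convDensity ((p.1, φ 2 p), p.2)‖ₑ ^ 2) := by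
          congr 1
          rw [← lintegral_const_mul' _ _ (by finiteness)]
          refine lintegral_congr fun p => ?_
          rw [hFG, enorm_smul, mul_pow]
          congr 2
          simp
      _ ≤ ENNReal.ofReal C * ((coordConst : ℝ≥0∞) ^ 2 * (4 ^ 5 *
            ((ENNReal.ofReal C * ∫⁻ x, ‖u x‖ₑ ^ 2 ∂surfaceMeasure (P 0)) *
              (ENNReal.ofReal C * ∫⁻ x, ‖v x‖ₑ ^ 2 ∂surfaceMeasure (P 1))))) := by
          gcongr
          refine (hd.lintegral_convDensity_graph_le (hc 2).lip).trans ?_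
          gcongr
          · exact (hc 0).lintegral_pull_le hu
          · exact (hc 1).lintegral_pull_le hv
      _ = _ := by
          rw [hCe]
          ring

/-! ### Convolutions of compactly supported functions -/

/-- Test functions determine a locally integrable function almost everywhere, and continuity removes
the exceptional set. This also identifies the convolutions obtained in different charts. -/
theorem IsContinuousConv.unique {S₁ S₂ : Set R3} {u v F F' : R3 → ℂ}
    (h : IsContinuousConv S₁ S₂ u v F) (h' : IsContinuousConv S₁ S₂ u v F') : F = F' := by
  have hae : ∀ᵐ x : R3, F x = F' x := by
    refine ae_eq_of_integral_contDiff_smul_eq h.1.locallyIntegrable h'.1.locallyIntegrable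
      fun g hg hgs => ?_
    have e1 : ContDiff ℝ ((⊤ : ℕ∞) : WithTop ℕ∞) fun x => (g x : ℂ) :=
      Complex.ofRealCLM.contDiff.comp hg
    have e2 : HasCompactSupport fun x => (g x : ℂ) :=
      hgs.comp_left (g := Complex.ofReal) Complex.ofReal_zero
    have := (h.2 _ e1 e2).trans (h'.2 _ e1 e2).symm
    simpa only [Complex.real_smul, mul_comm] using this
  exact (Continuous.ae_eq_iff_eq volume h.1 h'.1).1 hae

theorem IsCcOn.integrable {S : Set R3} [IsFiniteMeasure (surfaceMeasure S)] {u : R3 → ℂ}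
    (hu : IsCcOn S u) : Integrable u (surfaceMeasure S) := by
  obtain ⟨hc, K, hK, hKS, h0⟩ := hu
  have h1 : IntegrableOn u K (surfaceMeasure S) := (hc.mono hKS).integrableOn_compact hK
  exact h1.integrable_of_forall_notMem_eq_zero h0

theorem IsCcOn.memLp {S : Set R3} [IsFiniteMeasure (surfaceMeasure S)] {u : R3 → ℂ}
    (hu : IsCcOn S u) : MemLp u 2 (surfaceMeasure S) := by
  have hm := hu.integrable.aestronglyMeasurable
  obtain ⟨hc, K, hK, hKS, h0⟩ := hu
  obtain ⟨M, hM⟩ := hK.exists_bound_of_continuousOn (hc.mono hKS)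
  refine MemLp.of_bound hm (max M 0) (Eventually.of_forall fun x => ?_)
  by_cases hx : x ∈ K
  · exact (hM x hx).trans (le_max_left _ _)
  · rw [h0 x hx, norm_zero]; exact le_max_right _ _

theorem IsCcOn.add {S : Set R3} {u u' : R3 → ℂ} (hu : IsCcOn S u) (hu' : IsCcOn S u') :
    IsCcOn S (u + u') := by
  obtain ⟨hc, K, hK, hKS, h0⟩ := hu
  obtain ⟨hc', K', hK', hKS', h0'⟩ := hu'
  refine ⟨hc.add hc', K ∪ K', hK.union hK', union_subset hKS hKS', fun x hx => ?_⟩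
  rw [mem_union, not_or] at hx
  simp [h0 x hx.1, h0' x hx.2]

theorem IsCcOn.neg {S : Set R3} {u : R3 → ℂ} (hu : IsCcOn S u) : IsCcOn S (-u) := by
  obtain ⟨hc, K, hK, hKS, h0⟩ := hu
  exact ⟨hc.neg, K, hK, hKS, fun x hx => by simp [h0 x hx]⟩

theorem IsCcOn.sub {S : Set R3} {u u' : R3 → ℂ} (hu : IsCcOn S u) (hu' : IsCcOn S u') :
    IsCcOn S (u - u') := by
  rw [sub_eq_add_neg]; exact hu.add hu'.neg

theorem isCcOn_zero (S : Set R3) : IsCcOn S 0 :=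
  ⟨continuousOn_const, ∅, isCompact_empty, empty_subset _, fun _ _ => rfl⟩

theorem IsCcOn.sum {S : Set R3} {ι : Type*} (s : Finset ι) {u : ι → R3 → ℂ}
    (hu : ∀ i, IsCcOn S (u i)) : IsCcOn S (∑ i ∈ s, u i) := by
  classical
  induction s using Finset.induction_on with
  | empty => simpa using isCcOn_zero S
  | insert i s hi ih => rw [Finset.sum_insert hi]; exact (hu i).add ih

theorem IsCcOn.cutoff {S O : Set R3} {u : R3 → ℂ} (hu : IsCcOn S u) {χ : R3 → ℝ}
    (hχ : Continuous χ) (hO : tsupport χ ⊆ O) : IsCcOn (S ∩ O) fun x => χ x * u x := by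
  obtain ⟨hc, K, hK, hKS, h0⟩ := hu
  refine ⟨((Complex.continuous_ofReal.comp hχ).continuousOn.mul hc).mono inter_subset_left,
    K ∩ tsupport χ, hK.inter_right (isClosed_tsupport _), inter_subset_inter hKS hO,
    fun x hx => ?_⟩
  rw [mem_inter_iff, not_and_or] at hx
  rcases hx with hx | hx
  · simp [h0 x hx]
  · simp [image_eq_zero_of_notMem_tsupport hx]

/-- At points of the compact support, continuity relative to `S ∩ O` is continuity relative to `S`
because `O` is open; elsewhere `u` vanishes nearby. -/
theorem IsCcOn.mono {S O : Set R3} {u : R3 → ℂ} (hu : IsCcOn (S ∩ O) u) (hO : IsOpen O) :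
    IsCcOn S u := by
  obtain ⟨hc, K, hK, hKS, h0⟩ := hu
  refine ⟨fun x hx => ?_, K, hK, hKS.trans inter_subset_left, h0⟩
  by_cases hxK : x ∈ K
  · have := hc x (hKS hxK)
    rwa [ContinuousWithinAt, nhdsWithin_inter_of_mem' (mem_nhdsWithin_of_mem_nhds
      (hO.mem_nhds (hKS hxK).2))] at this
  · have : u =ᶠ[𝓝 x] fun _ => 0 := by
      filter_upwards [hK.isClosed.isOpen_compl.mem_nhds hxK] with y hy using h0 y hy
    exact (continuousAt_const.congr this.symm).continuousWithinAt

theorem integral_surfaceMeasure_inter {S O : Set R3} (hO : IsOpen O) {f : R3 → ℂ}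
    (hf : ∀ x ∉ O, f x = 0) : ∫ x, f x ∂surfaceMeasure (S ∩ O) = ∫ x, f x ∂surfaceMeasure S := by
  rw [surfaceMeasure, inter_comm, ← Measure.restrict_restrict hO.measurableSet]
  exact setIntegral_eq_integral_of_forall_compl_eq_zero hf

theorem surfaceConv_inter {S₁ S₂ O₁ O₂ : Set R3} (hO₁ : IsOpen O₁) (hO₂ : IsOpen O₂)
    {u v : R3 → ℂ} (hu : ∀ x ∉ O₁, u x = 0) (hv : ∀ x ∉ O₂, v x = 0) (ψ : R3 → ℂ) :
    surfaceConv (S₁ ∩ O₁) (S₂ ∩ O₂) u v ψ = surfaceConv S₁ S₂ u v ψ := by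
  unfold surfaceConv
  rw [integral_surfaceMeasure_inter hO₁ fun x hx => by simp [hu x hx]]
  refine integral_congr_ae (Eventually.of_forall fun x => ?_)
  exact integral_surfaceMeasure_inter hO₂ fun y hy => by simp [hv y hy]

theorem IsContinuousConv.of_inter {S₁ S₂ O₁ O₂ : Set R3} (hO₁ : IsOpen O₁) (hO₂ : IsOpen O₂)
    {u v F : R3 → ℂ} (hu : ∀ x ∉ O₁, u x = 0) (hv : ∀ x ∉ O₂, v x = 0)
    (h : IsContinuousConv (S₁ ∩ O₁) (S₂ ∩ O₂) u v F) : IsContinuousConv S₁ S₂ u v F :=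
  ⟨h.1, fun ψ h1 h2 => by rw [h.2 ψ h1 h2, surfaceConv_inter hO₁ hO₂ hu hv]⟩

/-! ### Bilinearity of the distributional convolution. -/

section Bilinear

variable {S₁ S₂ : Set R3} {ψ : R3 → ℂ}

theorem continuous_integral_translate {v : R3 → ℂ} (hv : Integrable v (surfaceMeasure S₂))
    (hψ : Continuous ψ) (hψs : HasCompactSupport ψ) :
    Continuous (fun x => ∫ y, v y * ψ (x + y) ∂surfaceMeasure S₂) := by
  obtain ⟨M, hM⟩ := hψs.exists_bound_of_continuous hψ
  refine continuous_of_dominated (bound := fun y => ‖v y‖ * M) (fun x => ?_) (fun x => ?_) ?_ ?_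
  · exact hv.aestronglyMeasurable.mul
      (by fun_prop : Continuous fun y => ψ (x + y)).aestronglyMeasurable
  · refine Eventually.of_forall fun y => ?_
    rw [norm_mul]; gcongr; exact hM _
  · exact hv.norm.mul_const _
  · exact Eventually.of_forall fun y => by fun_prop

theorem integrable_mul_translate {v : R3 → ℂ} (hv : Integrable v (surfaceMeasure S₂))
    (hψ : Continuous ψ) (hψs : HasCompactSupport ψ) (x : R3) :
    Integrable (fun y => v y * ψ (x + y)) (surfaceMeasure S₂) := by
  obtain ⟨M, hM⟩ := hψs.exists_bound_of_continuous hψ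
  exact hv.mul_bdd (c := M) (by fun_prop : Continuous fun y => ψ (x + y)).aestronglyMeasurable
    (Eventually.of_forall fun y => hM _)

theorem integrable_mul_integral_translate {u v : R3 → ℂ} (hu : Integrable u (surfaceMeasure S₁))
    (hv : Integrable v (surfaceMeasure S₂)) (hψ : Continuous ψ) (hψs : HasCompactSupport ψ) :
    Integrable (fun x => u x * ∫ y, v y * ψ (x + y) ∂surfaceMeasure S₂) (surfaceMeasure S₁) := by
  obtain ⟨M, hM⟩ := hψs.exists_bound_of_continuous hψ
  refine hu.mul_bdd (c := ∫ y, ‖v y‖ * M ∂surfaceMeasure S₂)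
    (continuous_integral_translate hv hψ hψs).aestronglyMeasurable (Eventually.of_forall fun x => ?_)
  refine norm_integral_le_of_norm_le (hv.norm.mul_const _) (Eventually.of_forall fun y => ?_)
  rw [norm_mul]; gcongr; exact hM _

theorem surfaceConv_eq (u v ψ : R3 → ℂ) : surfaceConv S₁ S₂ u v ψ =
    ∫ x, u x * ∫ y, v y * ψ (x + y) ∂surfaceMeasure S₂ ∂surfaceMeasure S₁ := by
  simp only [surfaceConv, mul_assoc]
  refine integral_congr_ae (Eventually.of_forall fun x => ?_)
  simp only
  rw [integral_const_mul]

theorem integrable_mul_test {F : R3 → ℂ} (hF : Continuous F) (hψ : Continuous ψ)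
    (hψs : HasCompactSupport ψ) : Integrable (fun z => F z * ψ z) :=
  (hF.mul hψ).integrable_of_hasCompactSupport hψs.mul_left

theorem IsContinuousConv.add_left {u u' v F F' : R3 → ℂ} (hu : Integrable u (surfaceMeasure S₁))
    (hu' : Integrable u' (surfaceMeasure S₁)) (hv : Integrable v (surfaceMeasure S₂))
    (h : IsContinuousConv S₁ S₂ u v F) (h' : IsContinuousConv S₁ S₂ u' v F') :
    IsContinuousConv S₁ S₂ (u + u') v (F + F') := by
  refine ⟨h.1.add h'.1, fun ψ hψ hψs => ?_⟩
  have hc := hψ.continuous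
  simp only [Pi.add_apply, add_mul]
  rw [integral_add (integrable_mul_test h.1 hc hψs) (integrable_mul_test h'.1 hc hψs), h.2 ψ hψ hψs,
    h'.2 ψ hψ hψs]
  simp only [surfaceConv_eq, Pi.add_apply, add_mul]
  rw [integral_add (integrable_mul_integral_translate hu hv hc hψs)
    (integrable_mul_integral_translate hu' hv hc hψs)]

theorem IsContinuousConv.add_right {u v v' F F' : R3 → ℂ} (hu : Integrable u (surfaceMeasure S₁))
    (hv : Integrable v (surfaceMeasure S₂)) (hv' : Integrable v' (surfaceMeasure S₂))
    (h : IsContinuousConv S₁ S₂ u v F) (h' : IsContinuousConv S₁ S₂ u v' F') :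
    IsContinuousConv S₁ S₂ u (v + v') (F + F') := by
  refine ⟨h.1.add h'.1, fun ψ hψ hψs => ?_⟩
  have hc := hψ.continuous
  simp only [Pi.add_apply, add_mul]
  rw [integral_add (integrable_mul_test h.1 hc hψs) (integrable_mul_test h'.1 hc hψs), h.2 ψ hψ hψs,
    h'.2 ψ hψ hψs]
  simp only [surfaceConv_eq, Pi.add_apply, add_mul]
  rw [← integral_add (integrable_mul_integral_translate hu hv hc hψs)
    (integrable_mul_integral_translate hu hv' hc hψs)]
  refine integral_congr_ae (Eventually.of_forall fun x => ?_)
  simp only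
  rw [integral_add (integrable_mul_translate hv hc hψs x) (integrable_mul_translate hv' hc hψs x),
    mul_add]

theorem isContinuousConv_zero_left (v : R3 → ℂ) : IsContinuousConv S₁ S₂ 0 v 0 :=
  ⟨continuous_const, fun ψ _ _ => by simp [surfaceConv]⟩

theorem isContinuousConv_zero_right (u : R3 → ℂ) : IsContinuousConv S₁ S₂ u 0 0 :=
  ⟨continuous_const, fun ψ _ _ => by simp [surfaceConv]⟩

theorem IsContinuousConv.sum_left {ι : Type*} (s : Finset ι) {u F : ι → R3 → ℂ} {v : R3 → ℂ}
    (hu : ∀ i, Integrable (u i) (surfaceMeasure S₁)) (hv : Integrable v (surfaceMeasure S₂))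
    (h : ∀ i, IsContinuousConv S₁ S₂ (u i) v (F i)) :
    IsContinuousConv S₁ S₂ (∑ i ∈ s, u i) v (∑ i ∈ s, F i) := by
  classical
  induction s using Finset.induction_on with
  | empty => simpa using isContinuousConv_zero_left v
  | insert i s hi ih =>
    rw [Finset.sum_insert hi, Finset.sum_insert hi]
    exact (h i).add_left (hu i) (integrable_finsetSum' _ fun j _ => hu j) hv ih

theorem IsContinuousConv.sum_right {ι : Type*} (s : Finset ι) {v F : ι → R3 → ℂ} {u : R3 → ℂ}
    (hu : Integrable u (surfaceMeasure S₁)) (hv : ∀ i, Integrable (v i) (surfaceMeasure S₂))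
    (h : ∀ i, IsContinuousConv S₁ S₂ u (v i) (F i)) :
    IsContinuousConv S₁ S₂ u (∑ i ∈ s, v i) (∑ i ∈ s, F i) := by
  classical
  induction s using Finset.induction_on with
  | empty => simpa using isContinuousConv_zero_right u
  | insert i s hi ih =>
    rw [Finset.sum_insert hi, Finset.sum_insert hi]
    exact (h i).add_right hu (hv i) (integrable_finsetSum' _ fun j _ => hv j) ih

end Bilinear

/-! ### From small pieces to the whole surfaces -/

theorem eLpNorm_two_sq {α : Type*} [MeasurableSpace α] (μ : Measure α) (f : α → ℂ) :
    eLpNorm f 2 μ ^ 2 = ∫⁻ x, ‖f x‖ₑ ^ 2 ∂μ := by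
  have := eLpNorm_nnreal_pow_eq_lintegral (μ := μ) (f := f) (p := 2) two_ne_zero
  simpa using this

/-- A ball of radius comparable to `ρ` has a partition of unity into boundedly many functions
supported in sets of diameter at most `ρ`. -/
theorem exists_partition (A : ℝ) : ∃ N : ℕ, ∀ (c : R3) (ρ R : ℝ), 0 < ρ → R ≤ A * ρ →
    ∃ (O : Fin N → Set R3) (χ : Fin N → R3 → ℝ),
      (∀ j, IsOpen (O j)) ∧ (∀ j, ∀ x ∈ O j, ∀ y ∈ O j, dist x y ≤ ρ) ∧
      (∀ j, Continuous (χ j)) ∧ (∀ j, tsupport (χ j) ⊆ O j) ∧ (∀ j x, |χ j x| ≤ 1) ∧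
      ∀ x ∈ closedBall c R, ∑ j, χ j x = 1 := by
  -- The cover is chosen at unit scale and then translated and dilated by `ρ`, so its cardinality
  -- depends on `A` alone. Radius 1/2 becomes `ρ/2`, which gives pieces of diameter at most `ρ`.
  obtain ⟨T, -, hTf, hT⟩ := (isCompact_closedBall (0 : R3) A).finite_cover_balls
    (show (0 : ℝ) < 1 / 2 by norm_num)
  have : Fintype T := hTf.fintype
  refine ⟨Fintype.card T, fun c ρ R hρ hR => ?_⟩
  set e := Fintype.equivFin T
  set O : Fin (Fintype.card T) → Set R3 := fun j => ball (c + ρ • (e.symm j : R3)) (ρ / 2) with hO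
  have hcover : closedBall c R ⊆ ⋃ j, O j := by
    intro x hx
    have h1 : ρ⁻¹ • (x - c) ∈ closedBall (0 : R3) A := by
      rw [mem_closedBall_zero_iff, norm_smul, norm_inv, Real.norm_of_nonneg hρ.le,
        inv_mul_le_iff₀ hρ]
      rw [mem_closedBall, dist_eq_norm] at hx
      linarith
    obtain ⟨t, ht, htx⟩ := mem_iUnion₂.1 (hT h1)
    refine mem_iUnion.2 ⟨e ⟨t, ht⟩, ?_⟩
    rw [mem_ball, dist_eq_norm] at htx
    simp only [hO, Equiv.symm_apply_apply, mem_ball, dist_eq_norm]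
    have e1 : x - (c + ρ • t) = ρ • (ρ⁻¹ • (x - c) - t) := by
      rw [smul_sub, smul_smul, mul_inv_cancel₀ hρ.ne', one_smul]; abel
    rw [e1, norm_smul, Real.norm_of_nonneg hρ.le]
    nlinarith
  obtain ⟨f, hf⟩ := PartitionOfUnity.exists_isSubordinate (isClosed_closedBall (x := c) (ε := R)) O
    (fun _ => isOpen_ball) hcover
  refine ⟨O, fun j => f j, fun _ => isOpen_ball, fun j x hx y hy => ?_, fun j => (f j).continuous,
    hf, fun j x => ?_, fun x hx => ?_⟩
  · have := dist_triangle_right x y (c + ρ • (e.symm j : R3))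
    rw [hO, mem_ball] at hx hy
    linarith
  · rw [abs_of_nonneg (f.nonneg j x)]
    exact f.le_one j x
  · rw [← finsum_eq_sum_of_fintype]
    exact f.sum_eq_one hx

theorem GraphChart.measure_lt_top {P : Set R3} {L : R3 ≃L[ℝ] (ℝ × ℝ) × ℝ} {φ : ℝ × ℝ → ℝ}
    {D : Set (ℝ × ℝ)} {φ' : ℝ × ℝ → ℝ × ℝ →L[ℝ] ℝ} {w : ℝ × ℝ → ℝ} {C : ℝ}
    (hc : GraphChart P L φ D φ' w C) (hP : Bornology.IsBounded P) :
    (μHE[2] : Measure R3) P < ⊤ := by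
  have hD : D ⊆ ((ContinuousLinearMap.fst ℝ (ℝ × ℝ) ℝ).comp (L : R3 →L[ℝ] (ℝ × ℝ) × ℝ)) '' P := by
    intro p hp
    exact ⟨_, hc.param_mem hp, by simp⟩
  have hDb : Bornology.IsBounded D :=
    (((ContinuousLinearMap.fst ℝ (ℝ × ℝ) ℝ).comp
      (L : R3 →L[ℝ] (ℝ × ℝ) × ℝ)).lipschitz.isBounded_image hP).subset hD
  have h1 := hc.lintegral_eq (f := fun _ => 1) aemeasurable_const
  rw [lintegral_one, surfaceMeasure, Measure.restrict_apply_univ] at h1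
  rw [h1]
  calc ∫⁻ p in D, ENNReal.ofReal (w p) * 1 ≤ ∫⁻ _ in D, ENNReal.ofReal C :=
        setLIntegral_mono' hc.isOpen.measurableSet fun p hp => by
          rw [mul_one]; exact ENNReal.ofReal_le_ofReal (hc.density_le p hp)
    _ = ENNReal.ofReal C * volume D := by simp
    _ < ⊤ := ENNReal.mul_lt_top ENNReal.ofReal_lt_top hDb.measure_lt_top

/-- The square of the constant in the local estimate. -/
noncomputable def localConst (θ : ℝ) : ℝ :=
  coordConst ^ 2 * 4 ^ 5 * ((18 / θ) ^ 2 * areaConst) ^ 3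

theorem localConst_nonneg (θ : ℝ) : 0 ≤ localConst θ := by unfold localConst; positivity

/-! ### Local estimates on pieces and their summation. -/

section Surfaces

variable {β b θ : ℝ} {S S' U : Fin 3 → Set R3} {Φ : Fin 3 → R3 → ℝ} {n : Fin 3 → R3 → R3}

/-- The same three inner products are reordered so that the normal of the `i`-th piece comes last in
`L i`. The order of the tangential pairs is the one built into `graphSum` and `pairMap`. -/
theorem exists_coordinate_triple (hS : ∀ i, IsHolderSurface β b (S i) (S' i) (U i) (Φ i) (n i))
    (hdet : ∀ σ : Fin 3 → R3, (∀ i, σ i ∈ S' i) →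
      θ ≤ (Matrix.of fun k i : Fin 3 => n i (σ i) k).det) (hθ : 0 < θ)
    {x : Fin 3 → R3} (hx : ∀ i, x i ∈ S i) :
    ∃ L : Fin 3 → R3 ≃L[ℝ] (ℝ × ℝ) × ℝ, ‖(L 1 : R3 →L[ℝ] (ℝ × ℝ) × ℝ)‖ ≤ 1 ∧
      (∀ x, L 0 x = (((L 1 x).2, (L 1 x).1.2), (L 1 x).1.1)) ∧
      (∀ x, L 2 x = (((L 1 x).1.1, (L 1 x).2), (L 1 x).1.2)) ∧
      (∀ i y, (L i y).2 = inner ℝ (n i (x i)) y) ∧ ∀ i y, ‖(L i).symm y‖ ≤ 18 / θ * ‖y‖ := by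
  have hxS : ∀ i, x i ∈ S' i := fun i => (hS i).subset (hx i)
  have hn : ∀ i, ‖n i (x i)‖ = 1 := fun i => (hS i).unit _ (hxS i)
  obtain ⟨L₀, h01, h02, h03⟩ := exists_coordinates hn hθ (hdet x hxS) 1 2 0 (by decide)
  obtain ⟨L₁, h11, h12, h13⟩ := exists_coordinates hn hθ (hdet x hxS) 0 2 1 (by decide)
  obtain ⟨L₂, h21, h22, h23⟩ := exists_coordinates hn hθ (hdet x hxS) 0 1 2 (by decide)
  refine ⟨![L₀, L₁, L₂], ?_, fun y => ?_, fun y => ?_, fun i y => ?_, fun i => ?_⟩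
  · exact ContinuousLinearMap.opNorm_le_bound _ zero_le_one fun y => by
      rw [one_mul]; exact h13 y
  · change L₀ y = _
    rw [h01]
    change _ = (((L₁ y).2, (L₁ y).1.2), (L₁ y).1.1)
    rw [h11]
  · change L₂ y = _
    rw [h21]
    change _ = (((L₁ y).1.1, (L₁ y).2), (L₁ y).1.2)
    rw [h11]
  · fin_cases i
    · exact congrArg Prod.snd (h01 y)
    · exact congrArg Prod.snd (h11 y)
    · exact congrArg Prod.snd (h21 y)
  · fin_cases i
    · exact h02
    · exact h12
    · exact h22

variable (hS : ∀ i, IsHolderSurface β b (S i) (S' i) (U i) (Φ i) (n i))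
  (hdet : ∀ σ : Fin 3 → R3, (∀ i, σ i ∈ S' i) →
    θ ≤ (Matrix.of fun k i : Fin 3 => n i (σ i) k).det)
  (hθ : 0 < θ) (hβ : 0 < β) (hb : 0 < b) {ρ : ℝ} (hρ : b * ρ ^ β ≤ θ / 288)

include hρ hθ in
-- This is the origin of 288 = 2 · 18 · 8: two Hölder errors, the inverse bound `18/θ`, and the
-- Lipschitz constant 1/8.
theorem small_of_le : 2 * (b * ρ ^ β) * (18 / θ) ≤ 1 / 8 := by
  calc 2 * (b * ρ ^ β) * (18 / θ) ≤ 2 * (θ / 288) * (18 / θ) := by gcongr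
    _ = 1 / 8 := by field_simp; norm_num

include hS hdet hθ hβ hb hρ

theorem exists_local_conv {O : Fin 3 → Set R3} (hO : ∀ i, IsOpen (O i))
    (hOρ : ∀ i, ∀ x ∈ O i, ∀ y ∈ O i, dist x y ≤ ρ) (hne : ∀ i, (S i ∩ O i).Nonempty)
    {u v : R3 → ℂ} (hu : IsCcOn (S 0 ∩ O 0) u) (hv : IsCcOn (S 1 ∩ O 1) v) :
    ∃ F, IsContinuousConv (S 0 ∩ O 0) (S 1 ∩ O 1) u v F ∧
      ∫⁻ x, ‖F x‖ₑ ^ 2 ∂surfaceMeasure (S 2 ∩ O 2) ≤ ENNReal.ofReal (localConst θ) *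
        ((∫⁻ x, ‖u x‖ₑ ^ 2 ∂surfaceMeasure (S 0 ∩ O 0)) *
          ∫⁻ x, ‖v x‖ₑ ^ 2 ∂surfaceMeasure (S 1 ∩ O 1)) := by
  choose x hx using hne
  obtain ⟨L, h1, h2, h3, h4, h5⟩ := exists_coordinate_triple hS hdet hθ (fun i => (hx i).1)
  choose φ D φ' w hc using fun i => (hS i).exists_graphChart hβ hb.le (hO i) (hOρ i) (hx i) (h4 i)
    (h5 i) (small_of_le hθ hρ)
  exact exists_conv_of_graphCharts (P := fun i => S i ∩ O i) hc h1 h2 h3 hu hv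

theorem measure_piece_lt_top (hne : ∀ i, (S i).Nonempty) (i : Fin 3) {O : Set R3} (hO : IsOpen O)
    (hOρ : ∀ x ∈ O, ∀ y ∈ O, dist x y ≤ ρ) : (μHE[2] : Measure R3) (S i ∩ O) < ⊤ := by
  rcases (S i ∩ O).eq_empty_or_nonempty with h | ⟨y, hy⟩
  · rw [h]; simp
  choose x hx using hne
  -- Coordinates need a base point on every surface; arbitrary points serve on the two others.
  obtain ⟨L, h1, h2, h3, h4, h5⟩ := exists_coordinate_triple hS hdet hθ (x := Function.update x i y)
    (fun j => by
      rcases eq_or_ne j i with rfl | hj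
      · simpa using hy.1
      · simpa [hj] using hx j)
  have h4' := h4 i
  rw [Function.update_self] at h4'
  obtain ⟨φ, D, φ', w, hc⟩ := (hS i).exists_graphChart hβ hb.le hO hOρ hy h4' (h5 i)
    (small_of_le hθ hρ)
  exact hc.measure_lt_top ((hS i).bounded.subset inter_subset_left)

variable {N : ℕ} {O : Fin 3 → Fin N → Set R3} {χ : Fin 3 → Fin N → R3 → ℝ}
  (hO : ∀ i j, IsOpen (O i j)) (hOρ : ∀ i j, ∀ x ∈ O i j, ∀ y ∈ O i j, dist x y ≤ ρ)
  (hχ : ∀ i j, Continuous (χ i j)) (hχO : ∀ i j, tsupport (χ i j) ⊆ O i j)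
  (hχ1 : ∀ i j x, |χ i j x| ≤ 1) (hsum : ∀ i, ∀ x ∈ S i, ∑ j, χ i j x = 1)

omit hS hdet hθ hβ hb hρ in
include hχO hsum in
theorem exists_mem_piece {i : Fin 3} {x : R3} (hx : x ∈ S i) : ∃ j, x ∈ O i j := by
  by_contra! h
  have : ∑ j, χ i j x = 0 := Finset.sum_eq_zero fun j _ =>
    image_eq_zero_of_notMem_tsupport fun h' => h j (hχO i j h')
  rw [hsum i x hx] at this
  exact one_ne_zero this

omit hS hdet hθ hβ hb hρ in
include hχO hsum in
theorem lintegral_le_sum_pieces (i : Fin 3) (f : R3 → ℝ≥0∞) :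
    ∫⁻ x, f x ∂surfaceMeasure (S i) ≤ ∑ j, ∫⁻ x, f x ∂surfaceMeasure (S i ∩ O i j) := by
  have hsub : S i ⊆ ⋃ j, S i ∩ O i j := fun x hx => by
    obtain ⟨j, hj⟩ := exists_mem_piece hχO hsum hx
    exact mem_iUnion.2 ⟨j, hx, hj⟩
  calc ∫⁻ x, f x ∂surfaceMeasure (S i) ≤ ∫⁻ x in ⋃ j, S i ∩ O i j, f x ∂μHE[2] :=
        lintegral_mono_set hsub
    _ ≤ ∑' j, ∫⁻ x in S i ∩ O i j, f x ∂μHE[2] := lintegral_iUnion_le _ _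
    _ = _ := tsum_fintype _

include hO hOρ hχO hsum in
theorem isFiniteMeasure_surfaceMeasure (hne : ∀ i, (S i).Nonempty) (i : Fin 3) :
    IsFiniteMeasure (surfaceMeasure (S i)) := by
  refine ⟨?_⟩
  have := lintegral_le_sum_pieces hχO hsum i (fun _ => 1)
  simp only [lintegral_one] at this
  refine this.trans_lt (ENNReal.sum_lt_top.2 fun j _ => ?_)
  rw [surfaceMeasure, Measure.restrict_apply_univ]
  exact measure_piece_lt_top hS hdet hθ hβ hb hρ hne i (hO i j) (hOρ i j)

include hO hOρ hχ hχO hχ1 hsum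

/-- Squared norms add over the `N` pieces of the third surface, whence the factor `N` under the
root. -/
theorem exists_piece_conv (hne : ∀ i, (S i).Nonempty) {u v : R3 → ℂ}
    (hu : IsCcOn (S 0) u) (hv : IsCcOn (S 1) v) (j k : Fin N) :
    ∃ F, IsContinuousConv (S 0) (S 1) (fun x => χ 0 j x * u x) (fun x => χ 1 k x * v x) F ∧
      eLpNorm F 2 (surfaceMeasure (S 2)) ≤ ENNReal.ofReal (Real.sqrt (N * localConst θ)) *
        (eLpNorm u 2 (surfaceMeasure (S 0)) * eLpNorm v 2 (surfaceMeasure (S 1))) := by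
  have hu' : IsCcOn (S 0 ∩ O 0 j) (fun x => χ 0 j x * u x) := hu.cutoff (hχ 0 j) (hχO 0 j)
  have hv' : IsCcOn (S 1 ∩ O 1 k) (fun x => χ 1 k x * v x) := hv.cutoff (hχ 1 k) (hχO 1 k)
  rcases (S 0 ∩ O 0 j).eq_empty_or_nonempty with h0 | h0
  · have : (fun x => (χ 0 j x : ℂ) * u x) = 0 := by
      obtain ⟨-, K, -, hKS, hK⟩ := hu'
      rw [h0, subset_empty_iff] at hKS
      ext x
      exact hK x (by simp [hKS])
    rw [this]
    exact ⟨0, isContinuousConv_zero_left _, by simp⟩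
  rcases (S 1 ∩ O 1 k).eq_empty_or_nonempty with h1 | h1
  · have : (fun x => (χ 1 k x : ℂ) * v x) = 0 := by
      obtain ⟨-, K, -, hKS, hK⟩ := hv'
      rw [h1, subset_empty_iff] at hKS
      ext x
      exact hK x (by simp [hKS])
    rw [this]
    exact ⟨0, isContinuousConv_zero_right _, by simp⟩
  have hloc : ∀ l, (S 2 ∩ O 2 l).Nonempty → ∃ F,
      IsContinuousConv (S 0) (S 1) (fun x => χ 0 j x * u x) (fun x => χ 1 k x * v x) F ∧
      ∫⁻ x, ‖F x‖ₑ ^ 2 ∂surfaceMeasure (S 2 ∩ O 2 l) ≤ ENNReal.ofReal (localConst θ) *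
        ((∫⁻ x, ‖u x‖ₑ ^ 2 ∂surfaceMeasure (S 0)) * ∫⁻ x, ‖v x‖ₑ ^ 2 ∂surfaceMeasure (S 1)) := by
    intro l hl
    obtain ⟨F, hF, hF'⟩ := exists_local_conv hS hdet hθ hβ hb hρ (O := ![O 0 j, O 1 k, O 2 l])
      (fun i => by fin_cases i; exacts [hO 0 j, hO 1 k, hO 2 l])
      (fun i => by fin_cases i; exacts [hOρ 0 j, hOρ 1 k, hOρ 2 l])
      (fun i => by fin_cases i; exacts [h0, h1, hl]) hu' hv'
    refine ⟨F, hF.of_inter (hO 0 j) (hO 1 k) (fun x hx => ?_) (fun x hx => ?_), hF'.trans ?_⟩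
    · rw [image_eq_zero_of_notMem_tsupport fun h => hx (hχO 0 j h)]; simp
    · rw [image_eq_zero_of_notMem_tsupport fun h => hx (hχO 1 k h)]; simp
    · have hle : ∀ (i : Fin 3) (m : Fin N) (f : R3 → ℂ),
          ∫⁻ x, ‖(χ i m x : ℂ) * f x‖ₑ ^ 2 ∂surfaceMeasure (S i ∩ O i m) ≤
            ∫⁻ x, ‖f x‖ₑ ^ 2 ∂surfaceMeasure (S i) := by
        intro i m f
        refine lintegral_mono' (Measure.restrict_mono inter_subset_left le_rfl) fun x => ?_
        have e1 : ‖(χ i m x : ℂ) * f x‖ₑ ≤ ‖f x‖ₑ := by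
          rw [← ofReal_norm, ← ofReal_norm]
          refine ENNReal.ofReal_le_ofReal ?_
          rw [norm_mul, Complex.norm_real, Real.norm_eq_abs]
          exact mul_le_of_le_one_left (norm_nonneg _) (hχ1 i m x)
        exact pow_le_pow_left' e1 2
      exact mul_le_mul_right (mul_le_mul' (hle 0 j u) (hle 1 k v)) _
  -- The local construction of `F` requires a piece of the third surface; any nonempty one will do,
  -- since by uniqueness the result is the same for all.
  obtain ⟨z, hz⟩ := hne 2
  obtain ⟨l₀, hl₀⟩ := exists_mem_piece hχO hsum hz
  obtain ⟨F, hF, -⟩ := hloc l₀ ⟨z, hz, hl₀⟩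
  refine ⟨F, hF, ?_⟩
  rw [← ENNReal.pow_le_pow_left_iff two_ne_zero]
  simp only [mul_pow, eLpNorm_two_sq]
  rw [← ENNReal.ofReal_pow (Real.sqrt_nonneg _),
    Real.sq_sqrt (mul_nonneg (Nat.cast_nonneg _) (localConst_nonneg θ)),
    ENNReal.ofReal_mul (Nat.cast_nonneg _), ENNReal.ofReal_natCast, mul_assoc]
  refine (lintegral_le_sum_pieces hχO hsum 2 _).trans ?_
  refine (Finset.sum_le_card_nsmul _ _ (ENNReal.ofReal (localConst θ) *
      ((∫⁻ x, ‖u x‖ₑ ^ 2 ∂surfaceMeasure (S 0)) * ∫⁻ x, ‖v x‖ₑ ^ 2 ∂surfaceMeasure (S 1)))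
    fun l _ => ?_).trans_eq ?_
  · rcases (S 2 ∩ O 2 l).eq_empty_or_nonempty with h | h
    · rw [h]; simp [surfaceMeasure]
    · obtain ⟨F', h1', h2'⟩ := hloc l h
      rwa [hF.unique h1']
  · simp

/-- The triangle inequality over the `N ^ 2` pairs of pieces of the first two surfaces gives the
factor `N ^ 2`. -/
theorem exists_global_conv (hne : ∀ i, (S i).Nonempty) {u v : R3 → ℂ}
    (hu : IsCcOn (S 0) u) (hv : IsCcOn (S 1) v) :
    ∃ F, IsContinuousConv (S 0) (S 1) u v F ∧
      eLpNorm F 2 (surfaceMeasure (S 2)) ≤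
        ENNReal.ofReal (N ^ 2 * Real.sqrt (N * localConst θ)) *
        (eLpNorm u 2 (surfaceMeasure (S 0)) * eLpNorm v 2 (surfaceMeasure (S 1))) := by
  have hfin := isFiniteMeasure_surfaceMeasure hS hdet hθ hβ hb hρ hO hOρ hχO hsum hne
  have := hfin 0
  have := hfin 1
  choose F hF hFn using exists_piece_conv hS hdet hθ hβ hb hρ hO hOρ hχ hχO hχ1 hsum hne hu hv
  have hdecomp : ∀ (i : Fin 3) (f : R3 → ℂ), IsCcOn (S i) f →
      ∑ j, (fun x => (χ i j x : ℂ) * f x) = f := by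
    intro i f hf
    ext x
    rw [Finset.sum_apply, ← Finset.sum_mul]
    by_cases hx : x ∈ S i
    · have := hsum i x hx
      rw [← Complex.ofReal_sum, this, Complex.ofReal_one, one_mul]
    · obtain ⟨-, K, -, hKS, hK⟩ := hf
      rw [hK x fun h => hx (hKS h), mul_zero]
  have hint : ∀ (i : Fin 3) (f : R3 → ℂ), IsCcOn (S i) f → ∀ j,
      Integrable (fun x => (χ i j x : ℂ) * f x) (surfaceMeasure (S i)) := by
    intro i f hf j
    have := hfin i
    exact ((hf.cutoff (hχ i j) (hχO i j)).mono (hO i j)).integrable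
  have hconv : IsContinuousConv (S 0) (S 1) u v (∑ j, ∑ k, F j k) := by
    have h1 : ∀ j, IsContinuousConv (S 0) (S 1) (fun x => χ 0 j x * u x) v (∑ k, F j k) := by
      intro j
      have := IsContinuousConv.sum_right Finset.univ (hint 0 u hu j) (hint 1 v hv) (hF j)
      rwa [hdecomp 1 v hv] at this
    have := IsContinuousConv.sum_left Finset.univ (hint 0 u hu) hv.integrable h1
    rwa [hdecomp 0 u hu] at this
  refine ⟨_, hconv, ?_⟩
  set B := ENNReal.ofReal (Real.sqrt (N * localConst θ)) *
        (eLpNorm u 2 (surfaceMeasure (S 0)) * eLpNorm v 2 (surfaceMeasure (S 1)))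
  have hm : ∀ j k, AEStronglyMeasurable (F j k) (surfaceMeasure (S 2)) :=
    fun j k => (hF j k).1.aestronglyMeasurable
  calc eLpNorm (∑ j, ∑ k, F j k) 2 (surfaceMeasure (S 2))
      ≤ ∑ j, eLpNorm (∑ k, F j k) 2 (surfaceMeasure (S 2)) :=
        eLpNorm_sum_le (fun j _ => Finset.aestronglyMeasurable_sum _ fun k _ => hm j k) (by norm_num)
    _ ≤ ∑ j : Fin N, ∑ k : Fin N, B := by
        gcongr with j
        refine (eLpNorm_sum_le (fun k _ => hm j k) (by norm_num)).trans ?_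
        gcongr with k
        exact hFn j k
    _ = _ := by
        rw [ENNReal.ofReal_mul (by positivity), ENNReal.ofReal_pow (by positivity),
          ENNReal.ofReal_natCast]
        simp only [Finset.sum_const, Finset.card_univ, Fintype.card_fin, nsmul_eq_mul, B]
        ring

end Surfaces

/-! ### Density and extension to square integrable functions -/

/-- The surface is the intersection of an open set with the complement of the open set where `Φ ≠ 0`
in `U`. Local closedness makes it locally compact, as the density of compactly supported functions
requires. -/
theorem IsHolderSurface.isLocallyClosed {β b : ℝ} {S S' U : Set R3} {Φ : R3 → ℝ} {n : R3 → R3}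
    (h : IsHolderSurface β b S S' U Φ n) : IsLocallyClosed S := by
  obtain ⟨V, hV, hSV⟩ := h.relOpen
  have hW : IsOpen (U ∩ Φ ⁻¹' {0}ᶜ) :=
    h.regular.1.continuousOn.isOpen_inter_preimage h.isOpen_U isOpen_compl_singleton
  have hW' : IsOpen (U ∩ ∇ Φ ⁻¹' {0}ᶜ) :=
    h.continuousOn_gradient.isOpen_inter_preimage h.isOpen_U isOpen_compl_singleton
  have : S = (U ∩ Φ ⁻¹' {0}ᶜ)ᶜ ∩ ((U ∩ ∇ Φ ⁻¹' {0}ᶜ) ∩ V) := by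
    rw [hSV, h.zeroSet]
    ext x
    simp only [mem_inter_iff, mem_ofPred_eq, mem_compl_iff, mem_preimage, mem_singleton_iff]
    tauto
  rw [this]
  exact hW.isClosed_compl.isLocallyClosed.inter (hW'.inter hV).isLocallyClosed

theorem exists_isCcOn_eLpNorm_sub_le {S : Set R3} (hS : IsLocallyClosed S)
    [IsFiniteMeasure (surfaceMeasure S)] {f : R3 → ℂ} (hf : MemLp f 2 (surfaceMeasure S))
    {ε : ℝ≥0∞} (hε : ε ≠ 0) :
    ∃ u, IsCcOn S u ∧ eLpNorm (u - f) 2 (surfaceMeasure S) ≤ ε := by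
  have hSm : MeasurableSet S := by
    obtain ⟨A, B, hA, hB, rfl⟩ := hS
    exact hA.measurableSet.inter hB.measurableSet
  have : LocallyCompactSpace S := hS.locallyCompactSpace
  set ν : Measure S := Measure.comap Subtype.val (μHE[2] : Measure R3)
  have hν : ν.map Subtype.val = surfaceMeasure S := map_comap_subtype_coe hSm _
  have hemb : MeasurableEmbedding (Subtype.val : S → R3) := MeasurableEmbedding.subtype_coe hSm
  have : IsFiniteMeasure ν := by
    refine ⟨?_⟩
    have h1 : ν univ = surfaceMeasure S univ := by
      rw [← hν, hemb.map_apply, preimage_univ]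
    rw [h1]
    exact measure_lt_top _ _
  have hf' : MemLp (f ∘ Subtype.val) 2 ν := by
    rw [← hemb.memLp_map_measure_iff, hν]
    exact hf
  obtain ⟨g, hgs, hgε, hgc, -⟩ := hf'.exists_hasCompactSupport_eLpNorm_sub_le (by norm_num) hε
  classical
  set u : R3 → ℂ := fun x => if h : x ∈ S then g ⟨x, h⟩ else 0 with hu
  have hug : u ∘ Subtype.val = g := by
    ext x
    simp [hu]
  refine ⟨u, ⟨?_, Subtype.val '' tsupport g, hgs.isCompact.image continuous_subtype_val, ?_, ?_⟩, ?_⟩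
  · rw [continuousOn_iff_continuous_domRestrict]
    have : S.domRestrict u = g := hug
    rwa [this]
  · rintro _ ⟨x, -, rfl⟩
    exact x.2
  · intro x hx
    by_cases h : x ∈ S
    · simp only [hu, dif_pos h]
      exact image_eq_zero_of_notMem_tsupport fun h' => hx ⟨_, h', rfl⟩
    · simp only [hu, dif_neg h]
  · have hsub : (u - f) ∘ Subtype.val = g - f ∘ Subtype.val := by rw [← hug]; rfl
    rw [← hν, hemb.eLpNorm_map_measure, hsub, eLpNorm_sub_comm]
    exact hgε

theorem exists_isCcOn_tendsto {S : Set R3} (hS : IsLocallyClosed S)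
    [IsFiniteMeasure (surfaceMeasure S)] {f : R3 → ℂ} (hf : MemLp f 2 (surfaceMeasure S)) :
    ∃ u : ℕ → R3 → ℂ, (∀ k, IsCcOn S (u k)) ∧
      Tendsto (fun k => eLpNorm (u k - f) 2 (surfaceMeasure S)) atTop (𝓝 0) := by
  choose u hu hu' using fun k : ℕ => exists_isCcOn_eLpNorm_sub_le hS hf
    (ε := ((k : ℝ≥0∞) + 1)⁻¹) (by simp)
  refine ⟨u, hu, tendsto_of_tendsto_of_tendsto_of_le_of_le tendsto_const_nhds ?_
    (fun _ => zero_le) hu'⟩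
  have := ENNReal.tendsto_inv_nat_nhds_zero.comp (tendsto_add_atTop_nat 1)
  simpa [Function.comp_def] using this

/-! ### Extension to L² by bilinear continuity. -/

section Extension

variable {S₁ S₂ S₃ : Set R3} [IsFiniteMeasure (surfaceMeasure S₁)]
  [IsFiniteMeasure (surfaceMeasure S₂)] {C : ℝ}

/-- The convolution estimate for continuous compactly supported functions. -/
def HasConvBound (S₁ S₂ S₃ : Set R3) (C : ℝ) : Prop :=
  ∀ u v, IsCcOn S₁ u → IsCcOn S₂ v → ∃ F, IsContinuousConv S₁ S₂ u v F ∧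
    eLpNorm F 2 (surfaceMeasure S₃) ≤ ENNReal.ofReal C *
      (eLpNorm u 2 (surfaceMeasure S₁) * eLpNorm v 2 (surfaceMeasure S₂))

variable (H : HasConvBound S₁ S₂ S₃ C) (hC : 0 ≤ C)

include H

omit [IsFiniteMeasure (surfaceMeasure S₁)] [IsFiniteMeasure (surfaceMeasure S₂)] in
theorem HasConvBound.eLpNorm_le {u v F : R3 → ℂ} (hu : IsCcOn S₁ u) (hv : IsCcOn S₂ v)
    (hF : IsContinuousConv S₁ S₂ u v F) :
    eLpNorm F 2 (surfaceMeasure S₃) ≤ ENNReal.ofReal C *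
      (eLpNorm u 2 (surfaceMeasure S₁) * eLpNorm v 2 (surfaceMeasure S₂)) := by
  obtain ⟨F', hF', h⟩ := H u v hu hv
  rwa [hF.unique hF']

theorem HasConvBound.memLp {u v F : R3 → ℂ} (hu : IsCcOn S₁ u) (hv : IsCcOn S₂ v)
    (hF : IsContinuousConv S₁ S₂ u v F) : MemLp F 2 (surfaceMeasure S₃) :=
  ⟨hF.1.aestronglyMeasurable, (H.eLpNorm_le hu hv hF).trans_lt
    (ENNReal.mul_lt_top ENNReal.ofReal_lt_top (ENNReal.mul_lt_top hu.memLp.2 hv.memLp.2))⟩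

include hC

theorem HasConvBound.norm_toLp_le {u v F : R3 → ℂ} (hu : IsCcOn S₁ u) (hv : IsCcOn S₂ v)
    (hF : IsContinuousConv S₁ S₂ u v F) :
    ‖(H.memLp hu hv hF).toLp F‖ ≤ C * (‖hu.memLp.toLp u‖ * ‖hv.memLp.toLp v‖) := by
  have h := ENNReal.toReal_mono (ENNReal.mul_lt_top ENNReal.ofReal_lt_top
    (ENNReal.mul_lt_top hu.memLp.2 hv.memLp.2)).ne (H.eLpNorm_le hu hv hF)
  rwa [ENNReal.toReal_mul, ENNReal.toReal_mul, ENNReal.toReal_ofReal hC, ← Lp.norm_toLp _ hu.memLp,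
    ← Lp.norm_toLp _ hv.memLp, ← Lp.norm_toLp _ (H.memLp hu hv hF)] at h

/-- From `u*v - u'*v' = (u - u')*v + u'*(v - v')`. -/
theorem HasConvBound.dist_toLp_le {u v F u' v' F' : R3 → ℂ} (hu : IsCcOn S₁ u) (hv : IsCcOn S₂ v)
    (hF : IsContinuousConv S₁ S₂ u v F) (hu' : IsCcOn S₁ u') (hv' : IsCcOn S₂ v')
    (hF' : IsContinuousConv S₁ S₂ u' v' F') :
    dist ((H.memLp hu hv hF).toLp F) ((H.memLp hu' hv' hF').toLp F') ≤
      C * (dist (hu.memLp.toLp u) (hu'.memLp.toLp u') * ‖hv.memLp.toLp v‖) +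
      C * (‖hu'.memLp.toLp u'‖ * dist (hv.memLp.toLp v) (hv'.memLp.toLp v')) := by
  obtain ⟨G₁, hG₁, -⟩ := H (u - u') v (hu.sub hu') hv
  obtain ⟨G₂, hG₂, -⟩ := H u' (v - v') hu' (hv.sub hv')
  have h1 : IsContinuousConv S₁ S₂ u' v (G₂ + F') := by
    have := hG₂.add_right hu'.integrable (hv.sub hv').integrable hv'.integrable hF'
    rwa [sub_add_cancel] at this
  have h2 : IsContinuousConv S₁ S₂ u v (G₁ + (G₂ + F')) := by
    have := hG₁.add_left (hu.sub hu').integrable hu'.integrable hv.integrable h1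
    rwa [sub_add_cancel] at this
  have hFeq : F - F' = G₁ + G₂ := by
    rw [hF.unique h2]; abel
  have m1 := H.memLp (hu.sub hu') hv hG₁
  have m2 := H.memLp hu' (hv.sub hv') hG₂
  have e : (H.memLp hu hv hF).toLp F - (H.memLp hu' hv' hF').toLp F' = m1.toLp G₁ + m2.toLp G₂ := by
    rw [← MemLp.toLp_sub, ← MemLp.toLp_add]
    congr 1
  rw [dist_eq_norm, e, dist_eq_norm, dist_eq_norm, ← MemLp.toLp_sub, ← MemLp.toLp_sub]
  exact (norm_add_le _ _).trans (add_le_add (H.norm_toLp_le hC (hu.sub hu') hv hG₁)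
    (H.norm_toLp_le hC hu' (hv.sub hv') hG₂))

/-- Two sequences of convolutions are asymptotic if the factors have the same limits. -/
theorem HasConvBound.tendsto_dist {ι : Type*} {l : Filter ι} {u v F u' v' F' : ι → R3 → ℂ}
    {f : Lp ℂ 2 (surfaceMeasure S₁)} {g : Lp ℂ 2 (surfaceMeasure S₂)}
    (hu : ∀ k, IsCcOn S₁ (u k)) (hv : ∀ k, IsCcOn S₂ (v k))
    (hF : ∀ k, IsContinuousConv S₁ S₂ (u k) (v k) (F k))
    (hu' : ∀ k, IsCcOn S₁ (u' k)) (hv' : ∀ k, IsCcOn S₂ (v' k))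
    (hF' : ∀ k, IsContinuousConv S₁ S₂ (u' k) (v' k) (F' k))
    (hut : Tendsto (fun k => (hu k).memLp.toLp (u k)) l (𝓝 f))
    (hvt : Tendsto (fun k => (hv k).memLp.toLp (v k)) l (𝓝 g))
    (hut' : Tendsto (fun k => (hu' k).memLp.toLp (u' k)) l (𝓝 f))
    (hvt' : Tendsto (fun k => (hv' k).memLp.toLp (v' k)) l (𝓝 g)) :
    Tendsto (fun k => dist ((H.memLp (hu k) (hv k) (hF k)).toLp (F k))
      ((H.memLp (hu' k) (hv' k) (hF' k)).toLp (F' k))) l (𝓝 0) := by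
  have hlim := (((hut.dist hut').mul hvt.norm).const_mul C).add
    ((hut'.norm.mul (hvt.dist hvt')).const_mul C)
  simp only [dist_self, zero_mul, mul_zero, add_zero] at hlim
  exact squeeze_zero (fun _ => dist_nonneg) (fun k => H.dist_toLp_le hC (hu k) (hv k) (hF k) (hu' k)
    (hv' k) (hF' k)) hlim

theorem HasConvBound.exists_restriction (hS₁ : IsLocallyClosed S₁) (hS₂ : IsLocallyClosed S₂)
    (f : Lp ℂ 2 (surfaceMeasure S₁)) (g : Lp ℂ 2 (surfaceMeasure S₂)) :
    ∃ h : Lp ℂ 2 (surfaceMeasure S₃), IsConvRestriction S₁ S₂ S₃ f g h ∧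
      (∀ h' : Lp ℂ 2 (surfaceMeasure S₃), IsConvRestriction S₁ S₂ S₃ f g h' → h' = h) ∧
      ‖h‖ ≤ C * ‖f‖ * ‖g‖ := by
  have key : ∀ {S : Set R3} (f : Lp ℂ 2 (surfaceMeasure S)) (u : ℕ → R3 → ℂ)
      (hu : ∀ k, MemLp (u k) 2 (surfaceMeasure S)),
      Tendsto (fun k => eLpNorm (u k - (f : R3 → ℂ)) 2 (surfaceMeasure S)) atTop (𝓝 0) ↔
        Tendsto (fun k => (hu k).toLp (u k)) atTop (𝓝 f) := by
    intro S f u hu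
    have := Lp.tendsto_Lp_iff_tendsto_eLpNorm'' (fi := atTop) u hu f (Lp.memLp f)
    rw [Lp.toLp_coeFn] at this
    exact this.symm
  obtain ⟨u, hu, hut⟩ := exists_isCcOn_tendsto hS₁ (Lp.memLp f)
  obtain ⟨v, hv, hvt⟩ := exists_isCcOn_tendsto hS₂ (Lp.memLp g)
  choose F hF _ using fun k => H (u k) (v k) (hu k) (hv k)
  have hut' := (key f u fun k => (hu k).memLp).1 hut
  have hvt' := (key g v fun k => (hv k).memLp).1 hvt
  -- A sequence is Cauchy when its two reindexings along pairs `(k, l)` are asymptotic, so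
  -- `tendsto_dist` applies on the product filter. Applied again below, it shows that the limit does
  -- not depend on the approximating sequences.
  have hcauchy : CauchySeq fun k => (H.memLp (hu k) (hv k) (hF k)).toLp (F k) := by
    rw [cauchySeq_iff_tendsto_dist_atTop_0, ← prod_atTop_atTop_eq]
    exact H.tendsto_dist hC (fun n : ℕ × ℕ => hu n.1) (fun n => hv n.1) (fun n => hF n.1)
      (fun n => hu n.2) (fun n => hv n.2) (fun n => hF n.2)
      (hut'.comp tendsto_fst) (hvt'.comp tendsto_fst) (hut'.comp tendsto_snd)
      (hvt'.comp tendsto_snd)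
  obtain ⟨h, hh⟩ := cauchySeq_tendsto_of_complete hcauchy
  refine ⟨h, ?_, ?_, ?_⟩
  · intro u' v' F' hu' hv' hF' hu't hv't
    rw [key h F' fun k => H.memLp (hu' k) (hv' k) (hF' k)]
    have hd := H.tendsto_dist hC hu hv hF hu' hv' hF' hut' hvt'
      ((key f u' fun k => (hu' k).memLp).1 hu't) ((key g v' fun k => (hv' k).memLp).1 hv't)
    exact tendsto_of_tendsto_of_dist hh hd
  · intro h' hh'
    have := hh' u v F hu hv hF hut hvt
    rw [key h' F fun k => H.memLp (hu k) (hv k) (hF k)] at this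
    exact tendsto_nhds_unique this hh
  · rw [mul_assoc]
    exact le_of_tendsto_of_tendsto' hh.norm ((hut'.norm.mul hvt'.norm).const_mul C)
      fun k => H.norm_toLp_le hC (hu k) (hv k) (hF k)

end Extension

/-- The number of pieces needed to cover a ball of relative radius `A`. -/
noncomputable def pieceCount (A : ℝ) : ℕ := (exists_partition A).choose

/-- The constant in the convolution estimate. -/
noncomputable def convConst (β a θ : ℝ) : ℝ :=
  pieceCount ((a * (288 / θ)) ^ β⁻¹) ^ 2 *
    Real.sqrt (pieceCount ((a * (288 / θ)) ^ β⁻¹) * localConst θ)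

theorem convConst_nonneg (β a θ : ℝ) : 0 ≤ convConst β a θ := by
  unfold convConst; positivity

theorem SurfaceAssumption.hasConvBound {β b θ R : ℝ} (hβ : 0 < β) (hb : 0 < b) (hθ : 0 < θ)
    (hR : 0 < R) {S : Fin 3 → Set R3} (hne : ∀ i, (S i).Nonempty) (hS : SurfaceAssumption β b θ S)
    (hdiam : ∀ i, Metric.diam (S i) ≤ R) :
    (∀ i, IsFiniteMeasure (surfaceMeasure (S i))) ∧ (∀ i, IsLocallyClosed (S i)) ∧
      HasConvBound (S 0) (S 1) (S 2) (convConst β (R ^ β * b) θ) := by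
  obtain ⟨S', U, Φ, n, hsurf, hdet⟩ := hS
  -- The scale `ρ` gives equality in `b ρ^β ≤ θ/288`, and `A = R/ρ` is the relative radius; it
  -- involves `R` and `b` only through `R^β b`.
  set A := (R ^ β * b * (288 / θ)) ^ β⁻¹ with hA
  set ρ := (θ / 288 / b) ^ β⁻¹ with hρ
  have hρ0 : 0 < ρ := by positivity
  have hbρ : b * ρ ^ β ≤ θ / 288 := by
    rw [hρ, Real.rpow_inv_rpow (by positivity) hβ.ne', mul_div_cancel₀ _ hb.ne']
  have hRA : R ≤ A * ρ := by
    rw [hA, hρ, ← Real.mul_rpow (by positivity) (by positivity)]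
    have : R ^ β * b * (288 / θ) * (θ / 288 / b) = R ^ β := by field_simp
    rw [this, Real.rpow_rpow_inv hR.le hβ.ne']
  choose c hc using hne
  choose O χ hO hOρ hχ hχO hχ1 hsum using fun i : Fin 3 =>
    (exists_partition A).choose_spec (c i) ρ R hρ0 hRA
  have hsum' : ∀ i, ∀ x ∈ S i, ∑ j, χ i j x = 1 := fun i x hx =>
    hsum i x (mem_closedBall.2
      ((Metric.dist_le_diam_of_mem (hsurf i).bounded hx (hc i)).trans (hdiam i)))
  have hdet' := fun σ hσ => (hdet σ hσ).1
  exact ⟨fun i => isFiniteMeasure_surfaceMeasure hsurf hdet' hθ hβ hb hbρ hO hOρ hχO hsum'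
    (fun i => ⟨c i, hc i⟩) i, fun i => (hsurf i).isLocallyClosed,
    fun u v hu hv => exists_global_conv hsurf hdet' hθ hβ hb hbρ hO hOρ hχ hχO hχ1 hsum'
      (fun i => ⟨c i, hc i⟩) hu hv⟩

end ConvolutionEstimate

theorem mainTheorem5 (β : ℝ) (hβ : 0 < β) (hβ1 : β ≤ 1) :
    ∃ C : ℝ → ℝ → ℝ, ∀ (b θ R : ℝ), 0 < b → 0 < θ → 0 < R →
      ∀ S : Fin 3 → Set R3, (∀ i, (S i).Nonempty) → SurfaceAssumption β b θ S →
        (∀ i, Metric.diam (S i) ≤ R) →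
        -- convolutions of continuous compactly supported functions are continuous functions
        (∀ u v : R3 → ℂ, IsCcOn (S 0) u → IsCcOn (S 1) v →
          ∃! F : R3 → ℂ, IsContinuousConv (S 0) (S 1) u v F) ∧
        -- the restriction is a well-defined `L²` function, with the bound
        (∀ (f : Lp ℂ 2 (surfaceMeasure (S 0))) (g : Lp ℂ 2 (surfaceMeasure (S 1))),
          ∃ h : Lp ℂ 2 (surfaceMeasure (S 2)),
            IsConvRestriction (S 0) (S 1) (S 2) f g h ∧
            (∀ h' : Lp ℂ 2 (surfaceMeasure (S 2)),
              IsConvRestriction (S 0) (S 1) (S 2) f g h' → h' = h) ∧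
            ‖h‖ ≤ C (R ^ β * b) θ * ‖f‖ * ‖g‖) := by
  refine ⟨convConst β, fun b θ R hb hθ hR S hne hS hdiam => ?_⟩
  obtain ⟨hfin, hcl, H⟩ := hS.hasConvBound hβ hb hθ hR hne hdiam
  have := hfin 0
  have := hfin 1
  refine ⟨fun u v hu hv => ?_, fun f g => ?_⟩
  · obtain ⟨F, hF, -⟩ := H u v hu hv
    exact ⟨F, hF, fun F' hF' => hF'.unique hF⟩
  · exact H.exists_restriction (convConst_nonneg _ _ _) (hcl 0) (hcl 1) f g
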